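/- **Definitions.** Permutations are written in one-line notation; $c(\pi)(j)=n+1-\pi(j)$ is the complement of a permutation $\pi$ of length $n$, and $\pi\oplus\sigma$, $\pi\ominus\sigma$ are the direct and skew sums. $\emptyset$ is the permutation of length $0$; the antipermutation $@$ is a formal symbol of length $-1$ with $c(@)=@$ and $1\oplus @=@\oplus 1=1\ominus @=@\ominus 1=\emptyset$. A *complete Baxter permutation* is a permutation $\pi$ of odd length such that $\pi(i)$ is even iff $i$ is even, and, whenever $\pi(x)=i$, $\pi(y)=i+1$ and $z$ is strictly between $x$ and $y$, $\pi(z)<i$ if $i$ is odd and $\pi(z)>i+1$ if $i$ is even. For a parity-preserving $\pi$, $\pi^o$ and $\pi^e$ denote the permutations that $\pi$ induces on its odd and even entries. A permutation is *doubly alternating* if it and its inverse are alternating (ascents and descents alternate, beginning with an ascent). A *snow leopard permutation* is a permutation of the form $\pi^e$, where $\pi$ is a complete Baxter permutation with $\pi^o$ doubly alternating; by convention $@$ is one too, with $@^e=@$ and $@^o=\emptyset$. For $n\ge -1$, $ET_n$ is the set of *even threads* of length $n$, i.e. of the $\pi^e$ of length $n$ with $\pi$ a snow leopard permutation of odd length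 (the length $-1$ of $@$ counts as odd); for $n\ge 0$, $OT_n$ is the set of *odd threads* of length $n$, defined likewise with $\pi^o$. A decomposition $\pi=c(\beta)\ominus 1\ominus\alpha$ of an even thread $\pi\neq @$ into an odd thread $\beta$ and an even thread $\alpha$ is the *leftmost decomposition* if $|\beta|+1$ is the least $j$ such that $c(\pi)(j)$ is a fixed point and a left-to-right maximum of $c(\pi)$, or $|\beta|=|\pi|$ if there is no such $j$. A *Catalan path* of length $n$ is a lattice path from $(0,0)$ to $(n,n)$ with steps $N=(0,1)$ and $E=(1,0)$ that never goes below $y=x$; $p^r$ is its reflection in $x+y=n$ (reverse the word and exchange $N$ and $E$), and $\emptyset$ is the empty path. $ENNE_n$ is the set of Catalan paths of length $n$ with no ascent (maximal run of $N$s) of length exactly two; $NEEN_n$ is the set of those without four consecutive steps $NEEN$. **Theorem.** 1. There are unique families of maps $H: ENNE_m\to ET_{m-1}$ and $J: NEEN_m\to OT_m$ $(m\ge 0)$ with $H(\emptyset)=@$, $J(\emptyset)=\emptyset$, and, for $a$ in some $ENNE_k$ and $b$ in some $NEEN_l$, $$H(p)=c(J(b))\ominus 1\ominus H(a)\quad\text{whenever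 } p=aNb^rE\in ENNE_m,$$ $$J(p)=(1\oplus c(H(a))\oplus 1)\ominus J(b)\quad\text{whenever } p=a^rNbE\in NEEN_m.$$ 2. There are unique families of maps $F: ET_{m-1}\to ENNE_m$ and $G: OT_m\to NEEN_m$ $(m\ge 0)$ with $F(@)=\emptyset$, $G(\emptyset)=\emptyset$, and, for an even thread $\alpha$ and an odd thread $\beta$, $$F(\pi)=F(\alpha)\,N\,G(\beta)^r\,E\quad\text{if } \pi=c(\beta)\ominus 1\ominus\alpha \text{ is the leftmost decomposition of the even thread }\pi,$$ $$G(\pi)=F(\alpha)^r\,N\,G(\beta)\,E\quad\text{if } \pi=(1\oplus c(\alpha)\oplus 1)\ominus\beta\text{ is an odd thread.}$$ 3. For every $m\ge 0$, $F$ and $G$ are two-sided inverses of $H$ and $J$: $F\circ H$, $H\circ F$, $G\circ J$ and $J\circ G$ are the identity maps of $ENNE_m$, $ET_{m-1}$, $NEEN_m$ and $OT_m$. 4. In particular, for every $n\ge 0$, the even threads of length $n$ are in bijection with the Catalan paths of length $n+1$ with no ascent of length exactly two, and the odd threads of length $n$ are in bijection with the Catalan paths of length $n$ that contain no $NEEN$.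 -/

import Mathlib

namespace SnowLeopard

/-! Permutations are written in one-line notation: a permutation of length `n` is the list
`π(1), …, π(n)` of its values, a rearrangement of `1, …, n`. -/

/-- `w` is the one-line notation of a permutation of `1, …, w.length`. -/
def IsPermWord (w : List ℕ) : Prop := w.Perm (List.range' 1 w.length)

/-- The permutation induced on the even entries: the subsequence of even entries, with
`2, 4, 6, …` relabelled as `1, 2, 3, …`. -/
def evenEntries (w : List ℕ) : List ℕ := (w.filter fun v => v % 2 = 0).map fun v => v / 2

/-- The permutation induced on the odd entries: the subsequence of odd entries, with
`1, 3, 5, …` relabelled as `1, 2, 3, …`. -/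
def oddEntries (w : List ℕ) : List ℕ := (w.filter fun v => v % 2 = 1).map fun v => (v + 1) / 2

/-- The one-line notation of the inverse: its `v`-th entry is the position (from 1) of `v`. -/
def invWord (w : List ℕ) : List ℕ := (List.range' 1 w.length).map fun v => w.idxOf v + 1

/-- Complete Baxter permutations. Here `w[x]? = some i` says that `π(x + 1) = i`. -/
structure IsCompleteBaxter (w : List ℕ) : Prop where
  isPerm : IsPermWord w
  odd_length : Odd w.length
  parity : ∀ x i : ℕ, w[x]? = some i → (Even i ↔ Even (x + 1))
  between : ∀ x y z i m : ℕ, w[x]? = some i → w[y]? = some (i + 1) → w[z]? = some m →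
    ((x < z ∧ z < y) ∨ (y < z ∧ z < x)) → (Odd i → m < i) ∧ (Even i → i + 1 < m)

/-- The (reduced) Baxter permutation `b` and the anti-Baxter permutation `a` are compatible: they
are induced on the odd and on the even entries of one complete Baxter permutation. -/
def Compatible (b a : List ℕ) : Prop :=
  ∃ w, IsCompleteBaxter w ∧ oddEntries w = b ∧ evenEntries w = a

/-- Alternating (up-down): ascents and descents alternate, beginning with an ascent. -/
def IsAlternating (w : List ℕ) : Prop :=
  ∀ j u v : ℕ, w[j]? = some u → w[j + 1]? = some v → (Even j → u < v) ∧ (Odd j → v < u)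

/-- Alternating with alternating inverse. -/
def IsDoublyAlternating (w : List ℕ) : Prop := IsAlternating w ∧ IsAlternating (invWord w)

/-- Snow leopard permutations of nonnegative length: the (anti-Baxter) permutations which are
compatible with a doubly alternating Baxter permutation. -/
def IsSnowLeopard (a : List ℕ) : Prop := ∃ b, IsDoublyAlternating b ∧ Compatible b a

/-! ### The antipermutation

A permutation that may also be the antipermutation `@`, of length `-1`, is an element of
`Option (List ℕ)`; `none` is `@` and `some w` is the permutation `w`. -/

/-- The length, which is `-1` for `@`. -/
def len : Option (List ℕ) → ℤ
  | none => -1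
  | some w => w.length

/-- Snow leopard permutations of odd length, with `@` included by convention. -/
def IsOddSnowLeopard : Option (List ℕ) → Prop
  | none => True
  | some w => IsSnowLeopard w ∧ Odd w.length

/-- `π ↦ π^e`, with `@^e = @`. -/
def evenPart : Option (List ℕ) → Option (List ℕ) := Option.map evenEntries

/-- `π ↦ π^o`, with `@^o = ∅`. -/
def oddPart : Option (List ℕ) → List ℕ
  | none => []
  | some w => oddEntries w

/-- Even threads of length `n ≥ -1`. -/
def ET (n : ℤ) : Set (Option (List ℕ)) :=
  {α | len α = n ∧ ∃ π, IsOddSnowLeopard π ∧ evenPart π = α}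

/-- Odd threads of length `n`. -/
def OT (n : ℕ) : Set (List ℕ) :=
  {β | β.length = n ∧ ∃ π, IsOddSnowLeopard π ∧ oddPart π = β}

/-! ### Operations on permutations -/

/-- The complement `c(π)(j) = n + 1 - π(j)`. -/
def compl (w : List ℕ) : List ℕ := w.map fun v => w.length + 1 - v

/-- `π ⊕ σ`. -/
def oplus (w v : List ℕ) : List ℕ := w ++ v.map fun i => w.length + i

/-- `π ⊖ σ`. -/
def ominus (w v : List ℕ) : List ℕ := (w.map fun i => v.length + i) ++ v

/-- The complement, with `c(@) = @`. -/
def complAnti : Option (List ℕ) → Option (List ℕ) := Option.map compl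

/-- `π ⊕ 1`, with `@ ⊕ 1 = ∅`. -/
def oplusOne : Option (List ℕ) → List ℕ
  | none => []
  | some w => oplus w [1]

/-- `1 ⊖ π`, with `1 ⊖ @ = ∅`. -/
def oneOminus : Option (List ℕ) → List ℕ
  | none => []
  | some w => ominus [1] w

/-- `c(β) ⊖ 1 ⊖ α`, for a permutation `β` and a permutation or antipermutation `α`. -/
def evenComb (β : List ℕ) (α : Option (List ℕ)) : List ℕ := ominus (compl β) (oneOminus α)

/-- `(1 ⊕ c(α) ⊕ 1) ⊖ β`, for a permutation or antipermutation `α` and a permutation `β`. -/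
def oddComb (α : Option (List ℕ)) (β : List ℕ) : List ℕ :=
  ominus (oplus [1] (oplusOne (complAnti α))) β

/-- The entry of `w` at the (0-based) index `k` is an eligible connector: the corresponding entry
of `c(w)` is a fixed point and a left-to-right maximum. -/
def EligibleAt (w : List ℕ) (k : ℕ) : Prop :=
  (compl w)[k]? = some (k + 1) ∧ ∀ j u : ℕ, j < k → (compl w)[j]? = some u → u < k + 1

/-- `k` is the (0-based) index of the leftmost eligible connector of `w`; by convention it is
`w.length`, the index just behind the last entry, if there is no eligible connector. -/
def IsLeftmostConnector (w : List ℕ) (k : ℕ) : Prop :=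
  (∀ j < k, ¬ EligibleAt w j) ∧ (EligibleAt w k ∨ k = w.length)

/-- `π = c(β) ⊖ 1 ⊖ α` is the leftmost decomposition of `π`: the middle `1`, whose index is
`β.length`, is the leftmost eligible connector. -/
def IsLeftmostDecomp (π β : List ℕ) (α : Option (List ℕ)) : Prop :=
  π = evenComb β α ∧ IsLeftmostConnector π β.length

/-! ### Catalan paths

A Catalan path of length `n` is a Dyck word of semilength `n`; the step `U` is a North step `N`
and the step `D` is an East step `E`. So `0` is the empty path, `p + q` is the concatenation `pq`,
and `p.nest` is `N p E`. -/

/-- Exchange `N` and `E`. -/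
def swapStep : DyckStep → DyckStep
  | DyckStep.U => DyckStep.D
  | DyckStep.D => DyckStep.U

theorem count_U_map_swap (l : List DyckStep) :
    (l.map swapStep).count DyckStep.U = l.count DyckStep.D := by
  induction l with
  | nil => rfl
  | cons s l ih => cases s <;> simp [swapStep, ih]

theorem count_D_map_swap (l : List DyckStep) :
    (l.map swapStep).count DyckStep.D = l.count DyckStep.U := by
  induction l with
  | nil => rfl
  | cons s l ih => cases s <;> simp [swapStep, ih]

/-- The reverse `p^r`: reverse the word and exchange `N` and `E`. -/
def rev (p : DyckWord) : DyckWord where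
  toList := p.toList.reverse.map swapStep
  count_U_eq_count_D := by
    rw [count_U_map_swap, count_D_map_swap, List.count_reverse, List.count_reverse,
      p.count_U_eq_count_D]
  count_D_le_count_U i := by
    rw [← List.map_take, count_U_map_swap, count_D_map_swap, List.take_reverse,
      List.count_reverse, List.count_reverse]
    have h1 := p.count_D_le_count_U (p.toList.length - i)
    have h2 := p.count_U_eq_count_D
    rw [← List.take_append_drop (p.toList.length - i) p.toList, List.count_append,
      List.count_append] at h2
    omega

/-- The path has an ascent (maximal run of consecutive `N`s) of length exactly two. -/
def HasAscentTwo (p : DyckWord) : Prop :=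
  ∃ x y : List DyckStep, p.toList = x ++ [DyckStep.U, DyckStep.U] ++ y ∧
    x.getLast? ≠ some DyckStep.U ∧ y.head? ≠ some DyckStep.U

/-- Catalan paths of length `n` with no ascent of length exactly two. -/
def ENNE (n : ℕ) : Set DyckWord := {p | p.semilength = n ∧ ¬ HasAscentTwo p}

/-- Catalan paths of length `n` without four consecutive steps `NEEN`. -/
def NEEN (n : ℕ) : Set DyckWord :=
  {p | p.semilength = n ∧ ¬ [DyckStep.U, DyckStep.D, DyckStep.D, DyckStep.U] <:+: p.toList}

/-! ### The recursive maps -/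

/-- A pair of families `H : ENNE_m → ET_{m-1}` and `J : NEEN_m → OT_m`. -/
abbrev PathToThread : Type :=
  (∀ m : ℕ, ENNE m → ET ((m : ℤ) - 1)) × (∀ m : ℕ, NEEN m → OT m)

/-- A pair of families `F : ET_{m-1} → ENNE_m` and `G : OT_m → NEEN_m`. -/
abbrev ThreadToPath : Type :=
  (∀ m : ℕ, ET ((m : ℤ) - 1) → ENNE m) × (∀ m : ℕ, OT m → NEEN m)

/-- The recursive description of `H` and `J`. -/
structure IsHJ (T : PathToThread) : Prop where
  /-- `H(∅) = @` -/
  H_empty : ∀ p : ENNE 0, p.1 = 0 → (T.1 0 p).1 = none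
  /-- `J(∅) = ∅` -/
  J_empty : ∀ p : NEEN 0, p.1 = 0 → (T.2 0 p).1 = []
  /-- if `p = a N b^r E` then `H(p) = c(J(b)) ⊖ 1 ⊖ H(a)` -/
  H_rec : ∀ (m k l : ℕ) (p : ENNE m) (a : ENNE k) (b : NEEN l),
    p.1 = a.1 + (rev b.1).nest → (T.1 m p).1 = some (evenComb (T.2 l b).1 (T.1 k a).1)
  /-- if `p = a^r N b E` then `J(p) = (1 ⊕ c(H(a)) ⊕ 1) ⊖ J(b)` -/
  J_rec : ∀ (m k l : ℕ) (p : NEEN m) (a : ENNE k) (b : NEEN l),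
    p.1 = rev a.1 + b.1.nest → (T.2 m p).1 = oddComb (T.1 k a).1 (T.2 l b).1

/-- The recursive description of `F` and `G`. -/
structure IsFG (T : ThreadToPath) : Prop where
  /-- `F(@) = ∅` -/
  F_anti : ∀ α : ET (((0 : ℕ) : ℤ) - 1), α.1 = none → (T.1 0 α).1 = 0
  /-- `G(∅) = ∅` -/
  G_empty : ∀ β : OT 0, β.1 = [] → (T.2 0 β).1 = 0
  /-- if `π = c(β) ⊖ 1 ⊖ α` is the leftmost decomposition then `F(π) = F(α) N G(β)^r E` -/
  F_rec : ∀ (m k l : ℕ) (π : ET ((m : ℤ) - 1)) (α : ET ((k : ℤ) - 1)) (β : OT l) (w : List ℕ),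
    π.1 = some w → IsLeftmostDecomp w β.1 α.1 →
      (T.1 m π).1 = (T.1 k α).1 + (rev (T.2 l β).1).nest
  /-- if `π = (1 ⊕ c(α) ⊕ 1) ⊖ β` then `G(π) = F(α)^r N G(β) E` -/
  G_rec : ∀ (m k l : ℕ) (π : OT m) (α : ET ((k : ℤ) - 1)) (β : OT l),
    π.1 = oddComb α.1 β.1 → (T.2 m π).1 = rev (T.1 k α).1 + (T.2 l β).1.nest

end SnowLeopard

-- Threads and paths are both encoded by binary trees, and the trees needed on the two sides satisfy
-- the same pair of mutually recursive conditions.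
--
-- Let C be the class of complete Baxter permutations with doubly alternating odd part and an even
-- part of odd length. Together with @, the even parts of its members are the snow leopard
-- permutations of odd length. The core is a recursion: the members of C are exactly (1 ⊕ 1 ⊕ c(w₁)
-- ⊕ 1 ⊕ 1) ⊖ 1 ⊖ w₂ with w₁, w₂ in C or equal to @ (`isAltBaxterWord_some_iff`). To split off the
-- first block one uses that C is closed under inversion, that values rise and fall with period four
-- in the position, and that even entries are preserved modulo 4. If v is the first entry, the block
-- ends just before the entry v - 1, or at the end if v = 1. If its last entry u were not the
-- maximum, u + 1 would lie inside the block, and this produces smaller and smaller boxes with the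
-- same defect (`no_spiral`).
--
-- Taking even entries in this recursion, the snow leopard permutations of odd length are @ and (1 ⊕
-- c(x) ⊕ 1) ⊖ 1 ⊖ y for x, y of the same kind. Their even and odd parts are c(x^o) ⊖ 1 ⊖ y^e and (1
-- ⊕ c(x^e) ⊕ 1) ⊖ y^o. Since x and y are independent, the threads are exactly what the two rules of
-- the theorem generate from @ and ∅. Thus each binary tree encodes an even thread and an odd
-- thread, and every thread arises.
--
-- An odd thread determines its two components, since its first entry reveals the length of the
-- second. For even threads there is one redundancy: c(1 ⊕ c(α') ⊕ 1) = 1 ⊖ α' ⊖ 1, so β = 1 ⊕ c(α')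
-- ⊕ 1 can be traded for β = ∅ and a longer α (`evenThread_rotate`). Forbidding this β at even nodes
-- makes every decomposition the leftmost one (`isLeftmostDecomp_of_evenReduced`), hence unique
-- (`thread_injective`).
--
-- On the path side, cutting at the last return identifies all trees with all Catalan paths, in an
-- even and an odd version. An ascent of length two is a factor ENNE once an E is put in front, and
-- reflection turns ENNE into NEEN. Passing from a and b to a N b^r E creates a new ENNE exactly
-- when b^r begins with NE, which is the forbidden right subtree; passing to a^r N b E creates no
-- new NEEN. So the same reduced trees encode the restricted paths (`path_reduced_iff`). The four
-- maps are the resulting composites, and induction on the tree shows that the recursions determine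
-- them.

namespace SnowLeopard

-- Structure of complete Baxter permutations with doubly alternating odd part

/-- `f` is a complete Baxter permutation of `1, …, n` with inverse `g`, where `n` is congruent to
`3` modulo `4`, and the permutation induced on the odd entries is doubly alternating. -/
structure AltBaxter (n : ℕ) (f g : ℕ → ℕ) : Prop where
  mod_four : n % 4 = 3
  mem : ∀ x, 1 ≤ x → x ≤ n → 1 ≤ f x ∧ f x ≤ n ∧ g (f x) = x
  inv_mem : ∀ i, 1 ≤ i → i ≤ n → 1 ≤ g i ∧ g i ≤ n ∧ f (g i) = i
  parity : ∀ x, 1 ≤ x → x ≤ n → f x % 2 = x % 2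
  between : ∀ i z, 1 ≤ i → i + 1 ≤ n → (g i < z ∧ z < g (i + 1) ∨ g (i + 1) < z ∧ z < g i) →
    (i % 2 = 1 → f z < i) ∧ (i % 2 = 0 → i + 1 < f z)
  alt : ∀ x, 1 ≤ x → x + 2 ≤ n → (x % 4 = 1 → f x < f (x + 2)) ∧ (x % 4 = 3 → f (x + 2) < f x)
  inv_alt : ∀ i, 1 ≤ i → i + 2 ≤ n →
    (i % 4 = 1 → g i < g (i + 2)) ∧ (i % 4 = 3 → g (i + 2) < g i)

namespace AltBaxter

variable {n : ℕ} {f g : ℕ → ℕ}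

theorem inv_parity (h : AltBaxter n f g) (i : ℕ) (h1 : 1 ≤ i) (h2 : i ≤ n) :
    g i % 2 = i % 2 := by
  have h3 := h.inv_mem i h1 h2
  have h4 := h.parity (g i) h3.1 h3.2.1
  rw [h3.2.2] at h4
  exact h4.symm

/-- Two consecutive values, both strictly between the entries at `x` and `x + 1`, are on the same
side of these entries. -/
theorem same_side (h : AltBaxter n f g) (x : ℕ) (i : ℕ) (hi1 : 1 ≤ i) (hi2 : i + 1 ≤ n)
    (hb : f x < i ∧ i + 1 < f (x + 1) ∨ f (x + 1) < i ∧ i + 1 < f x) :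
    g i < x ↔ g (i + 1) < x := by
  -- If `i` and `i + 1` were on opposite sides, both `x` and `x + 1` would lie between them. Their
  -- values are on both sides of `{i, i + 1}`, but the Baxter condition allows only one side.
  have h1 := h.between i x hi1 hi2
  have h2 := h.between i (x + 1) hi1 hi2
  have e1 := (h.inv_mem i hi1 (by omega)).2.2
  have e2 := (h.inv_mem (i + 1) (by omega) hi2).2.2
  have n1 : g i ≠ x := by rintro rfl; omega
  have n2 : g (i + 1) ≠ x := by rintro rfl; omega
  have n3 : g i ≠ x + 1 := by intro h3; rw [h3] at e1; omega
  have n4 : g (i + 1) ≠ x + 1 := by intro h3; rw [h3] at e2; omega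
  omega

/-- All values strictly between the entries at `x` and `x + 1` are on the same side of these
entries. -/
theorem same_side_all (h : AltBaxter n f g) (x lo hi : ℕ) (hlo : 1 ≤ lo) (hhi : hi ≤ n)
    (hb : f x = lo ∧ f (x + 1) = hi ∨ f (x + 1) = lo ∧ f x = hi) (d i : ℕ) (hi1 : lo < i)
    (hi2 : i + d < hi) : g i < x ↔ g (i + d) < x := by
  induction d with
  | zero => rfl
  | succ d ih =>
    rw [ih (by omega)]
    exact h.same_side x (i + d) (by omega) (by omega) (by omega)

/-- This is the Baxter condition for the inverse. All values between the two entries lie on one side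
by `same_side_all`, so it suffices to place one of them. The one used is the neighbour of the odd
entry of the two: the condition on that pair of consecutive values keeps the other entry from lying
between them. -/
theorem inv_between (h : AltBaxter n f g) (x i : ℕ) (hx1 : 1 ≤ x) (hx2 : x + 1 ≤ n)
    (hb : f x < i ∧ i < f (x + 1) ∨ f (x + 1) < i ∧ i < f x) :
    (x % 2 = 1 → g i < x) ∧ (x % 2 = 0 → x + 1 < g i) := by
  have m1 := h.mem x hx1 (by omega)
  have m2 := h.mem (x + 1) (by omega) hx2
  have p1 := h.parity x hx1 (by omega)
  have p2 := h.parity (x + 1) (by omega) hx2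
  have hin : 1 ≤ i ∧ i ≤ n := by omega
  have e1 := (h.inv_mem i hin.1 hin.2).2.2
  have n1 : g i ≠ x := by rintro rfl; omega
  have n3 : g i ≠ x + 1 := by intro h3; rw [h3] at e1; omega
  rcases hb with hb | hb
  · constructor
    · intro hx
      have key := h.same_side_all x (f x) (f (x + 1)) m1.1 m2.2.1 (Or.inl ⟨rfl, rfl⟩)
        (i - (f x + 1)) (f x + 1) (by omega) (by omega)
      rw [show f x + 1 + (i - (f x + 1)) = i by omega] at key
      rw [← key]
      have hc := h.between (f x) (x + 1) (by omega) (by omega)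
      rw [m1.2.2] at hc
      have e2 := (h.inv_mem (f x + 1) (by omega) (by omega)).2.2
      have n2 : g (f x + 1) ≠ x := by intro h3; rw [h3] at e2; omega
      have n4 : g (f x + 1) ≠ x + 1 := by intro h3; rw [h3] at e2; omega
      omega
    · intro hx
      have key := h.same_side_all x (f x) (f (x + 1)) m1.1 m2.2.1 (Or.inl ⟨rfl, rfl⟩)
        (f (x + 1) - 1 - i) i (by omega) (by omega)
      rw [show i + (f (x + 1) - 1 - i) = f (x + 1) - 1 by omega] at key
      have hc := h.between (f (x + 1) - 1) x (by omega) (by omega)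
      rw [show f (x + 1) - 1 + 1 = f (x + 1) by omega, m2.2.2] at hc
      have e2 := (h.inv_mem (f (x + 1) - 1) (by omega) (by omega)).2.2
      have n2 : g (f (x + 1) - 1) ≠ x := by intro h3; rw [h3] at e2; omega
      omega
  · constructor
    · intro hx
      have key := h.same_side_all x (f (x + 1)) (f x) m2.1 m1.2.1 (Or.inr ⟨rfl, rfl⟩)
        (f x - 1 - i) i (by omega) (by omega)
      rw [show i + (f x - 1 - i) = f x - 1 by omega] at key
      have hc := h.between (f x - 1) (x + 1) (by omega) (by omega)
      rw [show f x - 1 + 1 = f x by omega, m1.2.2] at hc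
      have e2 := (h.inv_mem (f x - 1) (by omega) (by omega)).2.2
      have n2 : g (f x - 1) ≠ x := by intro h3; rw [h3] at e2; omega
      have n4 : g (f x - 1) ≠ x + 1 := by intro h3; rw [h3] at e2; omega
      omega
    · intro hx
      have key := h.same_side_all x (f (x + 1)) (f x) m2.1 m1.2.1 (Or.inr ⟨rfl, rfl⟩)
        (i - (f (x + 1) + 1)) (f (x + 1) + 1) (by omega) (by omega)
      rw [show f (x + 1) + 1 + (i - (f (x + 1) + 1)) = i by omega] at key
      have hc := h.between (f (x + 1)) x (by omega) (by omega)
      rw [m2.2.2] at hc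
      omega

/-- Positions and values play the same role, so each lemma about consecutive values also yields one
about consecutive positions. -/
theorem symm (h : AltBaxter n f g) : AltBaxter n g f where
  mod_four := h.mod_four
  mem := h.inv_mem
  inv_mem := h.mem
  parity := h.inv_parity
  between x i hx1 hx2 hb := h.inv_between x i hx1 hx2 hb
  alt := h.inv_alt
  inv_alt := h.alt

/-- If the even value `i + 1` stood outside the interval between `i` and `i + 2`, one of these odd
values would separate it from the other, on the side that the Baxter condition forbids. -/
theorem inv_lt_of_odd (h : AltBaxter n f g) (i : ℕ) (h1 : 1 ≤ i) (h2 : i + 2 ≤ n)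
    (hi : i % 4 = 1) : g i < g (i + 1) ∧ g (i + 1) < g (i + 2) := by
  have a := (h.inv_alt i h1 h2).1 hi
  have b1 := h.between i (g (i + 2)) h1 (by omega)
  have b2 := h.between (i + 1) (g i) (by omega) (by omega)
  have e0 := h.inv_mem i h1 (by omega)
  have e1 := h.inv_mem (i + 1) (by omega) (by omega)
  have e2 := h.inv_mem (i + 2) (by omega) h2
  have n1 : g i ≠ g (i + 1) := by intro h3; rw [h3] at e0; omega
  have n2 : g (i + 1) ≠ g (i + 2) := by intro h3; rw [h3] at e1; omega
  rw [e2.2.2] at b1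
  rw [e0.2.2] at b2
  simp only [add_assoc, Nat.reduceAdd] at b2
  omega

theorem inv_gt_of_odd (h : AltBaxter n f g) (i : ℕ) (h1 : 1 ≤ i) (h2 : i + 2 ≤ n)
    (hi : i % 4 = 3) : g (i + 2) < g (i + 1) ∧ g (i + 1) < g i := by
  have a := (h.inv_alt i h1 h2).2 hi
  have b1 := h.between i (g (i + 2)) h1 (by omega)
  have b2 := h.between (i + 1) (g i) (by omega) (by omega)
  have e0 := h.inv_mem i h1 (by omega)
  have e1 := h.inv_mem (i + 1) (by omega) (by omega)
  have e2 := h.inv_mem (i + 2) (by omega) h2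
  have n1 : g i ≠ g (i + 1) := by intro h3; rw [h3] at e0; omega
  have n2 : g (i + 1) ≠ g (i + 2) := by intro h3; rw [h3] at e1; omega
  rw [e2.2.2] at b1
  rw [e0.2.2] at b2
  simp only [add_assoc, Nat.reduceAdd] at b2
  omega

/-- The relative position of two consecutive values depends on their residues modulo `4`. -/
theorem inv_step (h : AltBaxter n f g) (i : ℕ) (h1 : 1 ≤ i) (h2 : i + 1 ≤ n) :
    ((i % 4 = 1 ∨ i % 4 = 2) → g i < g (i + 1)) ∧
      ((i % 4 = 3 ∨ i % 4 = 0) → g (i + 1) < g i) := by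
  have hn := h.mod_four
  rcases (by omega : i % 4 = 1 ∨ i % 4 = 2 ∨ i % 4 = 3 ∨ i % 4 = 0) with hi | hi | hi | hi
  · have := h.inv_lt_of_odd i h1 (by omega) hi
    omega
  · have := h.inv_lt_of_odd (i - 1) (by omega) (by omega) (by omega)
    rw [show i - 1 + 1 = i by omega, show i - 1 + 2 = i + 1 by omega] at this
    omega
  · have := h.inv_gt_of_odd i h1 (by omega) hi
    omega
  · have := h.inv_gt_of_odd (i - 1) (by omega) (by omega) (by omega)
    rw [show i - 1 + 1 = i by omega, show i - 1 + 2 = i + 1 by omega] at this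
    omega

theorem step (h : AltBaxter n f g) (x : ℕ) (h1 : 1 ≤ x) (h2 : x + 1 ≤ n) :
    ((x % 4 = 1 ∨ x % 4 = 2) → f x < f (x + 1)) ∧
      ((x % 4 = 3 ∨ x % 4 = 0) → f (x + 1) < f x) :=
  h.symm.inv_step x h1 h2

/-- The even entries are preserved modulo `4`. -/
theorem mod_four_of_even (h : AltBaxter n f g) (x : ℕ) (h1 : 1 ≤ x) (h2 : x ≤ n)
    (hx : x % 2 = 0) : f x % 4 = x % 4 := by
  have hn := h.mod_four
  have m := h.mem x h1 h2
  have p := h.parity x h1 h2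
  have m' := h.mem (x - 1) (by omega) (by omega)
  have s := h.step (x - 1) (by omega) (by omega)
  rw [show x - 1 + 1 = x by omega] at s
  by_contra hne
  rcases (by omega : x % 4 = 2 ∧ f x % 4 = 0 ∨ x % 4 = 0 ∧ f x % 4 = 2) with hc | hc
  -- The residues give `f (x - 1) < f x` and put the value `f x + 1` to the left of `x`. Then `x -
  -- 1` lies strictly between the even value `f x` and its successor, so its entry would have to
  -- exceed both.
  · have v := h.inv_step (f x) (by omega) (by omega)
    have b := h.between (f x) (x - 1) (by omega) (by omega)
    have e := (h.inv_mem (f x + 1) (by omega) (by omega)).2.2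
    have ne : g (f x + 1) ≠ x - 1 := by intro h3; rw [h3] at e; omega
    rw [m.2.2] at v b
    omega
  · have v := h.inv_step (f x - 1) (by omega) (by omega)
    have b := h.between (f x - 1) (x - 1) (by omega) (by omega)
    have e := (h.inv_mem (f x - 1) (by omega) (by omega)).2.2
    have ne : g (f x - 1) ≠ x - 1 := by intro h3; rw [h3] at e; omega
    rw [show f x - 1 + 1 = f x by omega, m.2.2] at v b
    omega

/-- A box of positions and values, whose corners are entries and whose values are all taken inside
it, has no entry just above its right upper corner: otherwise there is a smaller such box. -/
theorem no_spiral (h : AltBaxter n f g) (d : ℕ) : ∀ p q v u : ℕ, q ≤ p + d → 1 ≤ p → q ≤ n →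
    1 ≤ v → u + 1 ≤ n → v ≤ u → f p = v → f q = u → u % 4 = 3 → q % 4 = 3 →
    (∀ i, v ≤ i → i ≤ u → p ≤ g i ∧ g i ≤ q) → (∀ x, p ≤ x → x ≤ q → v ≤ f x) →
    ¬ (p < g (u + 1) ∧ g (u + 1) < q) := by
  induction d with
  | zero => intros; omega
  | succ d ih =>
    intro p q v u hd hp hq hv hu hvu fp fq u4 q4 hval hpos ⟨hr1, hr2⟩
    have gp := (h.mem p hp (by omega)).2.2
    have gq := (h.mem q (by omega) hq).2.2
    rw [fp] at gp
    rw [fq] at gq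
    obtain ⟨r, hr⟩ : ∃ r, g (u + 1) = r := ⟨_, rfl⟩
    have fr := (h.inv_mem (u + 1) (by omega) hu).2.2
    rw [hr] at hr1 hr2 fr
    have hr4 : r % 4 = 0 := by
      have := h.symm.mod_four_of_even (u + 1) (by omega) hu (by omega)
      omega
    -- The values `u` (odd, at `q`) and `u + 1` (at `r`) are consecutive, so everything between them
    -- is smaller.
    have hbelow : ∀ z, r < z → z < q → f z < u := by
      intro z hz1 hz2
      have := h.between u z (by omega) hu
      rw [gq, hr] at this
      omega
    -- the left lower corner of the smaller box
    obtain ⟨v', fv⟩ : ∃ v', f (r + 1) = v' := ⟨_, rfl⟩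
    have gv := (h.mem (r + 1) (by omega) (by omega)).2.2
    have pv := h.parity (r + 1) (by omega) (by omega)
    have lev := hpos (r + 1) (by omega) (by omega)
    have ltu := hbelow (r + 1) (by omega) (by omega)
    rw [fv] at gv pv lev ltu
    -- The position `r` is even, so values between the entries at `r` and `r + 1` occur to the right
    -- of both.
    have hright : ∀ i, v' < i → i < u + 1 → r + 1 < g i := by
      intro i hi1 hi2
      have := h.inv_between r i (by omega) (by omega)
      rw [fr, fv] at this
      omega
    -- Otherwise `v'` is 3 modulo 4 and `v' + 1` stands to its left, against `hright`.
    have v4 : v' % 4 = 1 := by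
      by_contra hne
      have s1 := h.inv_step v' (by omega) (by omega)
      have s2 := hright (v' + 1) (by omega) (by omega)
      omega
    have hvv : v < v' := by
      rcases lev.lt_or_eq with hlt | rfl
      · exact hlt
      · omega
    -- the right upper corner of the smaller box
    obtain ⟨s, hs⟩ : ∃ s, g (v' - 1) = s := ⟨_, rfl⟩
    have fs := (h.inv_mem (v' - 1) (by omega) (by omega)).2.2
    have s4 := h.symm.mod_four_of_even (v' - 1) (by omega) (by omega) (by omega)
    have les := (hval (v' - 1) (by omega) (by omega)).2
    have lts := (h.inv_step (v' - 1) (by omega) (by omega)).2 (by omega)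
    rw [show v' - 1 + 1 = v' by omega, gv] at lts
    rw [hs] at fs s4 les lts
    have habove : ∀ z, r + 1 < z → z < s → v' < f z := by
      intro z hz1 hz2
      have := h.between (v' - 1) z (by omega) (by omega)
      rw [show v' - 1 + 1 = v' by omega, gv, hs] at this
      omega
    obtain ⟨u', fu⟩ : ∃ u', f (s - 1) = u' := ⟨_, rfl⟩
    have gu := (h.mem (s - 1) (by omega) (by omega)).2.2
    have pu := h.parity (s - 1) (by omega) (by omega)
    have ltu' := hbelow (s - 1) (by omega) (by omega)
    have gtv := habove (s - 1) (by omega) (by omega)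
    rw [fu] at gu pu ltu' gtv
    have hleft : ∀ i, v' - 1 < i → i < u' → g i < s - 1 := by
      intro i hi1 hi2
      have := h.inv_between (s - 1) i (by omega) (by omega)
      rw [show s - 1 + 1 = s by omega, fs, fu] at this
      omega
    have u4' : u' % 4 = 3 := by
      by_contra hne
      have s1 := h.inv_step (u' - 1) (by omega) (by omega)
      have s2 := hleft (u' - 1) (by omega) (by omega)
      rw [show u' - 1 + 1 = u' by omega] at s1
      omega
    -- The new box lies strictly inside the old one. The value `u' + 1` is to the right of `r + 1`
    -- by `hright`, and to the left of `s - 1` because `u'` is 3 modulo 4, so the defect recurs.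
    refine ih (r + 1) (s - 1) v' u' (by omega) (by omega) (by omega) (by omega) (by omega)
      (by omega) fv fu u4' (by omega) ?_ ?_ ⟨hright _ (by omega) (by omega), ?_⟩
    · intro i hi1 hi2
      constructor
      · rcases hi1.lt_or_eq with hlt | rfl
        · exact (hright i hlt (by omega)).le
        · omega
      · rcases hi2.lt_or_eq with hlt | rfl
        · exact (hleft i (by omega) hlt).le
        · omega
    · intro x hx1 hx2
      rcases hx1.lt_or_eq with hlt | rfl
      · exact (habove x hlt (by omega)).le
      · omega
    · have := (h.inv_step u' (by omega) (by omega)).2 (by omega)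
      omega

/-- The permutation is a skew sum whose first summand begins with its least entry and ends with its
greatest entry. -/
theorem exists_first_block (h : AltBaxter n f g) : ∃ q, q % 4 = 3 ∧ q ≤ n ∧ f 1 = n - q + 1 ∧
    f q = n ∧ (q < n → f (q + 1) = n - q) ∧ (∀ x, 1 ≤ x → x ≤ q → n - q + 1 ≤ f x) ∧
    (∀ i, n - q + 1 ≤ i → i ≤ n → g i ≤ q) := by
  have hn := h.mod_four
  obtain ⟨v, fv⟩ : ∃ v, f 1 = v := ⟨_, rfl⟩
  have mv := h.mem 1 (by omega) (by omega)
  have pv := h.parity 1 (by omega) (by omega)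
  rw [fv] at mv pv
  have v4 : v % 4 = 1 := by
    by_contra hne
    have s1 := h.inv_step (v - 1) (by omega) (by omega)
    have s2 := h.inv_mem (v - 1) (by omega) (by omega)
    rw [show v - 1 + 1 = v by omega] at s1
    omega
  -- the last position `q` of the block
  obtain ⟨q, q4, q1, qn, hlow, hqn, hqv⟩ : ∃ q, q % 4 = 3 ∧ 1 ≤ q ∧ q ≤ n ∧
      (∀ x, 1 ≤ x → x ≤ q → v ≤ f x) ∧ (q = n → v = 1) ∧ (q < n → 1 < v ∧ f (q + 1) = v - 1) := by
    rcases (by omega : v = 1 ∨ 1 < v) with rfl | hv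
    · exact ⟨n, hn, by omega, le_rfl, fun x h1 h2 => (h.mem x h1 h2).1, fun _ => rfl, by omega⟩
    · have s4 := h.symm.mod_four_of_even (v - 1) (by omega) (by omega) (by omega)
      have s1 := h.inv_mem (v - 1) (by omega) (by omega)
      -- The block stops just before the entry `v - 1`. This entry is divisible by 4, hence so is
      -- its position; and as it is even, everything between `v` and it exceeds `v`.
      refine ⟨g (v - 1) - 1, by omega, by omega, by omega, ?_, by omega, ?_⟩
      · intro x hx1 hx2
        rcases hx1.lt_or_eq with hlt | rfl
        · have := h.between (v - 1) x (by omega) (by omega)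
          rw [show v - 1 + 1 = v by omega] at this
          omega
        · omega
      · intro _
        rw [show g (v - 1) - 1 + 1 = g (v - 1) by omega]
        omega
  obtain ⟨u, fu⟩ : ∃ u, f q = u := ⟨_, rfl⟩
  have mu := h.mem q (by omega) (by omega)
  have pu := h.parity q (by omega) (by omega)
  have lu := hlow q (by omega) (by omega)
  rw [fu] at mu pu lu
  have hleft : ∀ i, v ≤ i → i < u → g i < q := by
    intro i hi1 hi2
    rcases qn.lt_or_eq with hlt | heq
    · have := h.inv_between q i (by omega) (by omega)
      rw [(hqv hlt).2, fu] at this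
      have := (hqv hlt).1
      omega
    · have s1 := h.inv_mem i (by omega) (by omega)
      have : g i ≠ q := by intro hc; rw [hc] at s1; omega
      omega
  have hvu : v ≠ u := by
    intro hc
    rw [hc] at mv
    omega
  have u4 : u % 4 = 3 := by
    by_contra hne
    have s1 := h.inv_step (u - 1) (by omega) (by omega)
    have s2 := hleft (u - 1) (by omega) (by omega)
    rw [show u - 1 + 1 = u by omega] at s1
    omega
  -- If `u < n`, then `u + 1` stands to the left of `u` because `u` is 3 modulo 4, inside the box
  -- with corners at positions `1` and `q`.
  have hun : u = n := by
    by_contra hne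
    have s1 := h.inv_step u (by omega) (by omega)
    have s2 := h.inv_mem (u + 1) (by omega) (by omega)
    refine h.no_spiral q 1 q v u (by omega) le_rfl qn (by omega) (by omega) lu fv fu u4 q4
      ?_ hlow ⟨?_, by omega⟩
    · intro i hi1 hi2
      refine ⟨(h.inv_mem i (by omega) (by omega)).1, ?_⟩
      rcases hi2.lt_or_eq with hlt | rfl
      · exact (hleft i hi1 hlt).le
      · omega
    · have : g (u + 1) ≠ 1 := by
        intro hc
        rw [hc] at s2
        omega
      omega
  have hle : ∀ i, v ≤ i → i ≤ n → g i ≤ q := by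
    intro i hi1 hi2
    rcases hi2.lt_or_eq with hlt | rfl
    · exact (hleft i hi1 (by omega)).le
    · rw [← hun]; omega
  -- the first `q` positions take exactly the values from `v` on
  have hcard : q = n + 1 - v := by
    have : Finset.image f (Finset.Icc 1 q) = Finset.Icc v n := by
      ext i
      simp only [Finset.mem_image, Finset.mem_Icc]
      constructor
      · rintro ⟨x, ⟨hx1, hx2⟩, rfl⟩
        exact ⟨hlow x hx1 hx2, (h.mem x hx1 (by omega)).2.1⟩
      · rintro ⟨hi1, hi2⟩
        have s1 := h.inv_mem i (by omega) hi2
        exact ⟨g i, ⟨s1.1, hle i hi1 hi2⟩, s1.2.2⟩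
    have hc := congrArg Finset.card this
    rw [Finset.card_image_of_injOn, Nat.card_Icc, Nat.card_Icc] at hc
    · omega
    · intro x hx y hy hxy
      simp only [Finset.coe_Icc, Set.mem_Icc] at hx hy
      have s1 := (h.mem x hx.1 (by omega)).2.2
      have s2 := (h.mem y hy.1 (by omega)).2.2
      rw [← s1, ← s2, hxy]
  obtain rfl : v = n - q + 1 := by omega
  refine ⟨q, q4, qn, fv, by omega, ?_, hlow, hle⟩
  intro hlt
  rw [(hqv hlt).2]
  omega

end AltBaxter

end SnowLeopard

-- Wrapping and stacking, and their inverses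

namespace SnowLeopard

/-- The inverse of `wrapFun`, in terms of the inverse. -/
def wrapInv (n : ℕ) (g : ℕ → ℕ) (i : ℕ) : ℕ := if i ≤ 2 ∨ n + 2 < i then i else g (n + 3 - i) + 2

/-- The permutation `1 ⊕ 1 ⊕ c(f) ⊕ 1 ⊕ 1` of `1, …, n + 4`. -/
def wrapFun (n : ℕ) (f : ℕ → ℕ) (x : ℕ) : ℕ := if x ≤ 2 ∨ n + 2 < x then x else n + 3 - f (x - 2)

/-- The permutation `f₁ ⊖ 1 ⊖ f₂` of `1, …, a + 1 + b`. -/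
def stackFun (a b : ℕ) (f₁ f₂ : ℕ → ℕ) (x : ℕ) : ℕ :=
  if x ≤ a then f₁ x + (b + 1) else if x = a + 1 then b + 1 else f₂ (x - (a + 1))

namespace AltBaxter

theorem three : AltBaxter 3 id id where
  mod_four := rfl
  mem x h1 h2 := ⟨h1, h2, rfl⟩
  inv_mem x h1 h2 := ⟨h1, h2, rfl⟩
  parity x _ _ := rfl
  between i z _ _ h := by simp only [id] at h; omega
  alt x _ _ := by simp only [id]; omega
  inv_alt x _ _ := by simp only [id]; omega

theorem wrap {n : ℕ} {f g : ℕ → ℕ} (h : AltBaxter n f g) :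
    AltBaxter (n + 4) (wrapFun n f) (wrapInv n g) where
  mod_four := by have := h.mod_four; omega
  mem x h1 h2 := by
    unfold wrapFun
    split_ifs with hx
    · refine ⟨h1, h2, ?_⟩
      unfold wrapInv
      rw [if_pos hx]
    · have m := h.mem (x - 2) (by omega) (by omega)
      refine ⟨by omega, by omega, ?_⟩
      unfold wrapInv
      rw [if_neg (by omega), show n + 3 - (n + 3 - f (x - 2)) = f (x - 2) by omega, m.2.2]
      omega
  inv_mem i h1 h2 := by
    unfold wrapInv
    split_ifs with hx
    · refine ⟨h1, h2, ?_⟩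
      unfold wrapFun
      rw [if_pos hx]
    · have m := h.inv_mem (n + 3 - i) (by omega) (by omega)
      refine ⟨by omega, by omega, ?_⟩
      unfold wrapFun
      rw [if_neg (by omega), Nat.add_sub_cancel, m.2.2]
      omega
  parity x h1 h2 := by
    have hn := h.mod_four
    unfold wrapFun
    split_ifs with hx
    · rfl
    · have m := h.mem (x - 2) (by omega) (by omega)
      have p := h.parity (x - 2) (by omega) (by omega)
      omega
  between i z h1 h2 hz := by
    have hn := h.mod_four
    rcases (by omega : i = 1 ∨ i = 2 ∨ (3 ≤ i ∧ i ≤ n + 1) ∨ i = n + 2 ∨ i = n + 3) with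
      rfl | rfl | hi | rfl | rfl
    · simp only [wrapInv] at hz
      rw [if_pos (by omega), if_pos (by omega)] at hz
      omega
    -- The value 3 of the wrapped permutation is the complement of the old maximum `n`.
    · have m := h.inv_mem n (by omega) le_rfl
      simp only [wrapInv] at hz
      rw [if_pos (by omega), if_neg (by omega), show n + 3 - (2 + 1) = n by omega] at hz
      have mz := h.mem (z - 2) (by omega) (by omega)
      have ne : f (z - 2) ≠ n := by
        intro hc
        rw [hc] at mz
        omega
      simp only [wrapFun]
      rw [if_neg (by omega)]
      omega
    · have m := h.inv_mem (n + 2 - i) (by omega) (by omega)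
      have m' := h.inv_mem (n + 2 - i + 1) (by omega) (by omega)
      simp only [wrapInv] at hz
      rw [if_neg (by omega), if_neg (by omega), show n + 3 - (i + 1) = n + 2 - i by omega,
        show n + 3 - i = n + 2 - i + 1 by omega] at hz
      have b := h.between (n + 2 - i) (z - 2) (by omega) (by omega) (by omega)
      have mz := h.mem (z - 2) (by omega) (by omega)
      simp only [wrapFun]
      rw [if_neg (by omega)]
      omega
    · have m := h.inv_mem 1 (by omega) (by omega)
      simp only [wrapInv] at hz
      rw [if_neg (by omega), if_pos (by omega), show n + 3 - (n + 2) = 1 by omega] at hz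
      have mz := h.mem (z - 2) (by omega) (by omega)
      have ne : f (z - 2) ≠ 1 := by
        intro hc
        rw [hc] at mz
        omega
      simp only [wrapFun]
      rw [if_neg (by omega)]
      omega
    · simp only [wrapInv] at hz
      rw [if_pos (by omega), if_pos (by omega)] at hz
      omega
  alt x h1 h2 := by
    have hn := h.mod_four
    rcases (by omega : x ≤ 2 ∨ (3 ≤ x ∧ x ≤ n) ∨ n + 1 ≤ x) with hx | hx | hx
    · have m := h.mem x (by omega) (by omega)
      unfold wrapFun
      rw [if_pos (by omega), if_neg (by omega), Nat.add_sub_cancel]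
      omega
    · have a := h.alt (x - 2) (by omega) (by omega)
      have m := h.mem (x - 2) (by omega) (by omega)
      have m' := h.mem x (by omega) (by omega)
      rw [Nat.sub_add_cancel (by omega)] at a
      unfold wrapFun
      rw [if_neg (by omega), if_neg (by omega), Nat.add_sub_cancel]
      omega
    · have m := h.mem (x - 2) (by omega) (by omega)
      unfold wrapFun
      rw [if_neg (by omega), if_pos (by omega)]
      omega
  inv_alt i h1 h2 := by
    have hn := h.mod_four
    rcases (by omega : i ≤ 2 ∨ (3 ≤ i ∧ i ≤ n) ∨ n + 1 ≤ i) with hx | hx | hx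
    · have m := h.inv_mem (n + 3 - (i + 2)) (by omega) (by omega)
      unfold wrapInv
      rw [if_pos (by omega), if_neg (by omega)]
      omega
    · have a := h.inv_alt (n + 1 - i) (by omega) (by omega)
      rw [show n + 1 - i + 2 = n + 3 - i by omega] at a
      unfold wrapInv
      rw [if_neg (by omega), if_neg (by omega), show n + 3 - (i + 2) = n + 1 - i by omega]
      omega
    · have m := h.inv_mem (n + 3 - i) (by omega) (by omega)
      unfold wrapInv
      rw [if_neg (by omega), if_pos (by omega)]
      omega

theorem stackFun_left {a b x : ℕ} {f₁ f₂ : ℕ → ℕ} (hx : x ≤ a) :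
    stackFun a b f₁ f₂ x = f₁ x + (b + 1) := if_pos hx

theorem stackFun_mid {a b x : ℕ} {f₁ f₂ : ℕ → ℕ} (hx : x = a + 1) :
    stackFun a b f₁ f₂ x = b + 1 := by
  unfold stackFun
  rw [if_neg (by omega), if_pos hx]

theorem stackFun_right {a b x : ℕ} {f₁ f₂ : ℕ → ℕ} (hx : a + 1 < x) :
    stackFun a b f₁ f₂ x = f₂ (x - (a + 1)) := by
  unfold stackFun
  rw [if_neg (by omega), if_neg (by omega)]

/-- The inverse of a stack is the stack of the inverses in the opposite order, so this serves for
both directions. -/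
theorem stackFun_mem {a b : ℕ} {f₁ g₁ f₂ g₂ : ℕ → ℕ}
    (h₁ : ∀ x, 1 ≤ x → x ≤ a → 1 ≤ f₁ x ∧ f₁ x ≤ a ∧ g₁ (f₁ x) = x)
    (h₂ : ∀ x, 1 ≤ x → x ≤ b → 1 ≤ f₂ x ∧ f₂ x ≤ b ∧ g₂ (f₂ x) = x)
    (x : ℕ) (hx1 : 1 ≤ x) (hx2 : x ≤ a + 1 + b) :
    1 ≤ stackFun a b f₁ f₂ x ∧ stackFun a b f₁ f₂ x ≤ a + 1 + b ∧
      stackFun b a g₂ g₁ (stackFun a b f₁ f₂ x) = x := by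
  rcases (by omega : x ≤ a ∨ x = a + 1 ∨ a + 1 < x) with hx | hx | hx
  · have m := h₁ x hx1 hx
    rw [stackFun_left hx, stackFun_right (by omega), Nat.add_sub_cancel]
    omega
  · rw [stackFun_mid hx, stackFun_mid rfl]
    omega
  · have m := h₂ (x - (a + 1)) (by omega) (by omega)
    rw [stackFun_right hx, stackFun_left (by omega)]
    omega

/-- Since `a + 1` is divisible by 4, residues are unchanged in the second summand. The only odd pair
across the connector is `a`, `a + 2`, where a descent is required and the skew sum provides it. -/
theorem stackFun_alt {a b : ℕ} {f₁ f₂ : ℕ → ℕ} (ha : a % 4 = 3)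
    (h₁ : ∀ x, 1 ≤ x → x ≤ a → 1 ≤ f₁ x)
    (h₂ : ∀ x, 1 ≤ x → x ≤ b → f₂ x ≤ b)
    (a₁ : ∀ x, 1 ≤ x → x + 2 ≤ a →
      (x % 4 = 1 → f₁ x < f₁ (x + 2)) ∧ (x % 4 = 3 → f₁ (x + 2) < f₁ x))
    (a₂ : ∀ x, 1 ≤ x → x + 2 ≤ b →
      (x % 4 = 1 → f₂ x < f₂ (x + 2)) ∧ (x % 4 = 3 → f₂ (x + 2) < f₂ x))
    (x : ℕ) (hx1 : 1 ≤ x) (hx2 : x + 2 ≤ a + 1 + b) :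
    (x % 4 = 1 → stackFun a b f₁ f₂ x < stackFun a b f₁ f₂ (x + 2)) ∧
      (x % 4 = 3 → stackFun a b f₁ f₂ (x + 2) < stackFun a b f₁ f₂ x) := by
  rcases (by omega : x + 2 ≤ a ∨ x + 2 = a + 1 ∨ x = a ∨ x = a + 1 ∨ a + 1 < x) with
    hx | hx | hx | hx | hx
  · have := a₁ x hx1 hx
    rw [stackFun_left (by omega), stackFun_left hx]
    omega
  · omega
  · have := h₁ x (by omega) (by omega)
    have := h₂ (x + 2 - (a + 1)) (by omega) (by omega)
    rw [stackFun_left (by omega), stackFun_right (by omega)]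
    omega
  · omega
  · have := a₂ (x - (a + 1)) (by omega) (by omega)
    rw [stackFun_right hx, stackFun_right (by omega),
      show x + 2 - (a + 1) = x - (a + 1) + 2 by omega]
    omega

/-- The connector has the even value `b + 1`. Between it and the odd value `b` only smaller entries
of the second summand occur, and between it and `b + 2` only larger entries of the first, as the
Baxter condition demands. -/
theorem stack {a b : ℕ} {f₁ g₁ f₂ g₂ : ℕ → ℕ} (h₁ : AltBaxter a f₁ g₁)
    (h₂ : AltBaxter b f₂ g₂) :
    AltBaxter (a + 1 + b) (stackFun a b f₁ f₂) (stackFun b a g₂ g₁) where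
  mod_four := by have := h₁.mod_four; have := h₂.mod_four; omega
  mem := stackFun_mem h₁.mem h₂.mem
  inv_mem i hi1 hi2 := by
    have := stackFun_mem h₂.inv_mem h₁.inv_mem i hi1 (by omega)
    omega
  parity x hx1 hx2 := by
    have := h₁.mod_four
    have := h₂.mod_four
    rcases (by omega : x ≤ a ∨ x = a + 1 ∨ a + 1 < x) with hx | hx | hx
    · have := h₁.parity x hx1 hx
      rw [stackFun_left hx]
      omega
    · rw [stackFun_mid hx]
      omega
    · have := h₂.parity (x - (a + 1)) (by omega) (by omega)
      rw [stackFun_right hx]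
      omega
  between i z hi1 hi2 hz := by
    have ha := h₁.mod_four
    have hb := h₂.mod_four
    rcases (by omega : i + 1 ≤ b ∨ i = b ∨ i = b + 1 ∨ b + 1 < i) with hi | hi | hi | hi
    · have m := h₂.inv_mem i hi1 (by omega)
      have m' := h₂.inv_mem (i + 1) (by omega) hi
      rw [stackFun_left (by omega), stackFun_left hi] at hz
      have := h₂.between i (z - (a + 1)) hi1 hi (by omega)
      rw [stackFun_right (by omega)]
      exact this
    · have m := h₂.inv_mem i hi1 (by omega)
      rw [stackFun_left (by omega), stackFun_mid (by omega)] at hz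
      have mz := h₂.mem (z - (a + 1)) (by omega) (by omega)
      have : f₂ (z - (a + 1)) ≠ i := by
        intro hc
        rw [hc] at mz
        omega
      rw [stackFun_right (by omega)]
      omega
    · have m := h₁.inv_mem 1 (by omega) (by omega)
      rw [stackFun_mid hi, stackFun_right (by omega), show i + 1 - (b + 1) = 1 by omega] at hz
      have mz := h₁.mem z (by omega) (by omega)
      have : f₁ z ≠ 1 := by
        intro hc
        rw [hc] at mz
        omega
      rw [stackFun_left (by omega)]
      omega
    · have m := h₁.inv_mem (i - (b + 1)) (by omega) (by omega)
      have m' := h₁.inv_mem (i - (b + 1) + 1) (by omega) (by omega)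
      rw [stackFun_right hi, stackFun_right (by omega),
        show i + 1 - (b + 1) = i - (b + 1) + 1 by omega] at hz
      have := h₁.between (i - (b + 1)) z (by omega) (by omega) (by omega)
      rw [stackFun_left (by omega)]
      omega
  alt := stackFun_alt h₁.mod_four (fun x hx1 hx2 => (h₁.mem x hx1 hx2).1)
    (fun x hx1 hx2 => (h₂.mem x hx1 hx2).2.1) h₁.alt h₂.alt
  inv_alt i hi1 hi2 := stackFun_alt h₂.mod_four (fun x hx1 hx2 => (h₂.inv_mem x hx1 hx2).1)
    (fun x hx1 hx2 => (h₁.inv_mem x hx1 hx2).2.1) h₂.inv_alt h₁.inv_alt i hi1 (by omega)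

/-! ### Decomposition -/

variable {n : ℕ} {f g : ℕ → ℕ}

/-- The first block of a skew sum. -/
theorem block (h : AltBaxter n f g) {q : ℕ} (q4 : q % 4 = 3) (qn : q ≤ n)
    (hf : ∀ x, 1 ≤ x → x ≤ q → n - q + 1 ≤ f x) (hg : ∀ i, n - q + 1 ≤ i → i ≤ n → g i ≤ q) :
    AltBaxter q (fun x => f x - (n - q)) (fun i => g (i + (n - q))) := by
  have hn := h.mod_four
  refine ⟨q4, ?_, ?_, ?_, ?_, ?_, ?_⟩
  · intro x hx1 hx2
    have m := h.mem x hx1 (by omega)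
    have := hf x hx1 hx2
    rw [Nat.sub_add_cancel (by omega)]
    omega
  · intro i hi1 hi2
    have m := h.inv_mem (i + (n - q)) (by omega) (by omega)
    have := hg (i + (n - q)) (by omega) (by omega)
    omega
  · intro x hx1 hx2
    have p := h.parity x hx1 (by omega)
    have := hf x hx1 hx2
    omega
  · intro i z hi1 hi2 hz
    beta_reduce at hz ⊢
    rw [show i + 1 + (n - q) = i + (n - q) + 1 by omega] at hz
    have b := h.between (i + (n - q)) z (by omega) (by omega) hz
    have g1 := hg (i + (n - q)) (by omega) (by omega)
    have g2 := hg (i + (n - q) + 1) (by omega) (by omega)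
    have := hf z (by omega) (by omega)
    omega
  · intro x hx1 hx2
    have a := h.alt x hx1 (by omega)
    have := hf x hx1 (by omega)
    have := hf (x + 2) (by omega) hx2
    omega
  · intro i hi1 hi2
    have a := h.inv_alt (i + (n - q)) (by omega) (by omega)
    rw [show i + 2 + (n - q) = i + (n - q) + 2 by omega]
    omega

/-- What follows the first block of a skew sum, without its leading greatest entry. -/
theorem tail (h : AltBaxter n f g) {q : ℕ} (q4 : q % 4 = 3) (qn : q < n)
    (hq : f (q + 1) = n - q) (hf : ∀ x, 1 ≤ x → x ≤ q → n - q + 1 ≤ f x)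
    (hg : ∀ i, n - q + 1 ≤ i → i ≤ n → g i ≤ q) :
    AltBaxter (n - (q + 1)) (fun x => f (x + (q + 1))) (fun i => g i - (q + 1)) := by
  have hn := h.mod_four
  have gq := (h.mem (q + 1) (by omega) (by omega)).2.2
  rw [hq] at gq
  have key : ∀ x, q + 1 < x → x ≤ n → f x + (q + 1) ≤ n := by
    intro x hx1 hx2
    have m := h.mem x (by omega) hx2
    have := hg (f x)
    have : f x ≠ n - q := by
      intro hc
      rw [hc] at m
      omega
    omega
  have key' : ∀ i, 1 ≤ i → i + (q + 1) ≤ n → q + 1 < g i := by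
    intro i hi1 hi2
    have m := h.inv_mem i hi1 (by omega)
    have := hf (g i)
    have : g i ≠ q + 1 := by
      intro hc
      rw [hc] at m
      omega
    omega
  refine ⟨by omega, ?_, ?_, ?_, ?_, ?_, ?_⟩
  · intro x hx1 hx2
    have m := h.mem (x + (q + 1)) (by omega) (by omega)
    have := key (x + (q + 1)) (by omega) (by omega)
    omega
  · intro i hi1 hi2
    have m := h.inv_mem i hi1 (by omega)
    have := key' i hi1 (by omega)
    rw [Nat.sub_add_cancel (by omega)]
    omega
  · intro x hx1 hx2
    have p := h.parity (x + (q + 1)) (by omega) (by omega)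
    omega
  · intro i z hi1 hi2 hz
    have k1 := key' i hi1 (by omega)
    have k2 := key' (i + 1) (by omega) (by omega)
    exact h.between i (z + (q + 1)) hi1 (by omega) (by omega)
  · intro x hx1 hx2
    have a := h.alt (x + (q + 1)) (by omega) (by omega)
    rw [show x + 2 + (q + 1) = x + (q + 1) + 2 by omega]
    omega
  · intro i hi1 hi2
    have a := h.inv_alt i hi1 (by omega)
    have k1 := key' i hi1 (by omega)
    have k2 := key' (i + 2) (by omega) (by omega)
    omega

/-- If the first entry is the least one, the second entry is the second least one. -/
theorem apply_two (h : AltBaxter n f g) (h1 : f 1 = 1) : f 2 = 2 := by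
  have hn := h.mod_four
  have b := h.between 1 2 le_rfl (by omega)
  have g1 := (h.mem 1 le_rfl (by omega)).2.2
  rw [h1] at g1
  have m := h.mem 2 (by omega) (by omega)
  have m2 := h.inv_mem 2 (by omega) (by omega)
  have : g 2 ≠ 1 := by
    intro hc
    rw [hc] at m2
    omega
  rcases (by omega : g 2 = 2 ∨ 2 < g 2) with hc | hc
  · rw [hc] at m2
    omega
  · norm_num at b
    omega

/-- If the last entry is the greatest one, the entry before it is the second greatest one. -/
theorem apply_sub_one (h : AltBaxter n f g) (h1 : f n = n) : f (n - 1) = n - 1 := by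
  have hn := h.mod_four
  have b := h.between (n - 1) (n - 1) (by omega) (by omega)
  have g1 := (h.mem n (by omega) le_rfl).2.2
  rw [h1] at g1
  have m := h.mem (n - 1) (by omega) (by omega)
  have m2 := h.inv_mem (n - 1) (by omega) (by omega)
  rw [show n - 1 + 1 = n by omega, g1] at b
  have : g (n - 1) ≠ n := by
    intro hc
    rw [hc] at m2
    omega
  rcases (by omega : g (n - 1) = n - 1 ∨ g (n - 1) < n - 1) with hc | hc
  · rw [hc] at m2
    omega
  · omega

/-- What is left of a permutation which begins with its least and ends with its greatest entry. -/
theorem unwrap (h : AltBaxter n f g) (h1 : f 1 = 1) (hn : f n = n) (h3 : n ≠ 3) :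
    AltBaxter (n - 4) (fun x => n - 1 - f (x + 2)) (fun i => g (n - 1 - i) - 2) := by
  have n4 := h.mod_four
  have h2 := h.apply_two h1
  have hn1 := h.apply_sub_one hn
  have g1 := (h.mem 1 le_rfl (by omega)).2.2
  have g2 := (h.mem 2 (by omega) (by omega)).2.2
  have gn := (h.mem n (by omega) le_rfl).2.2
  have gn1 := (h.mem (n - 1) (by omega) (by omega)).2.2
  rw [h1] at g1
  rw [h2] at g2
  rw [hn] at gn
  rw [hn1] at gn1
  have key : ∀ x, 3 ≤ x → x + 2 ≤ n → 3 ≤ f x ∧ f x + 2 ≤ n := by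
    intro x hx1 hx2
    have m := h.mem x (by omega) (by omega)
    have : f x ≠ 1 := by intro hc; rw [hc] at m; omega
    have : f x ≠ 2 := by intro hc; rw [hc] at m; omega
    have : f x ≠ n := by intro hc; rw [hc] at m; omega
    have : f x ≠ n - 1 := by intro hc; rw [hc] at m; omega
    omega
  have key' : ∀ x, 3 ≤ x → x + 2 ≤ n → 3 ≤ g x ∧ g x + 2 ≤ n := by
    intro x hx1 hx2
    have m := h.inv_mem x (by omega) (by omega)
    have : g x ≠ 1 := by intro hc; rw [hc] at m; omega
    have : g x ≠ 2 := by intro hc; rw [hc] at m; omega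
    have : g x ≠ n := by intro hc; rw [hc] at m; omega
    have : g x ≠ n - 1 := by intro hc; rw [hc] at m; omega
    omega
  refine ⟨by omega, ?_, ?_, ?_, ?_, ?_, ?_⟩
  · intro x hx1 hx2
    have m := h.mem (x + 2) (by omega) (by omega)
    have := key (x + 2) (by omega) (by omega)
    rw [show n - 1 - (n - 1 - f (x + 2)) = f (x + 2) by omega]
    omega
  · intro i hi1 hi2
    have m := h.inv_mem (n - 1 - i) (by omega) (by omega)
    have := key' (n - 1 - i) (by omega) (by omega)
    rw [Nat.sub_add_cancel (by omega)]
    omega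
  · intro x hx1 hx2
    have p := h.parity (x + 2) (by omega) (by omega)
    have := key (x + 2) (by omega) (by omega)
    omega
  · intro i z hi1 hi2 hz
    beta_reduce at hz ⊢
    have k1 := key' (n - 1 - i) (by omega) (by omega)
    have k2 := key' (n - 1 - (i + 1)) (by omega) (by omega)
    have b := h.between (n - 1 - (i + 1)) (z + 2) (by omega) (by omega)
    rw [show n - 1 - (i + 1) + 1 = n - 1 - i by omega] at b
    have := key (z + 2) (by omega) (by omega)
    omega
  · intro x hx1 hx2
    have a := h.alt (x + 2) (by omega) (by omega)
    have := key (x + 2) (by omega) (by omega)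
    have := key (x + 2 + 2) (by omega) (by omega)
    omega
  · intro i hi1 hi2
    have a := h.inv_alt (n - 1 - (i + 2)) (by omega) (by omega)
    rw [show n - 1 - (i + 2) + 2 = n - 1 - i by omega] at a
    have := key' (n - 1 - i) (by omega) (by omega)
    have := key' (n - 1 - (i + 2)) (by omega) (by omega)
    omega

end AltBaxter

end SnowLeopard

-- One-line notation and the recursion for complete Baxter words

namespace SnowLeopard

/-- The one-line notation of the restriction of `f` to `1, …, n`. -/
def word (n : ℕ) (f : ℕ → ℕ) : List ℕ := (List.range n).map fun x => f (x + 1)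

@[simp] theorem length_word (n : ℕ) (f : ℕ → ℕ) : (word n f).length = n := by simp [word]

theorem word_congr {n : ℕ} {f f' : ℕ → ℕ} (h : ∀ x, 1 ≤ x → x ≤ n → f x = f' x) :
    word n f = word n f' := by
  unfold word
  refine List.map_congr_left fun x hx => h _ (by omega) ?_
  have := List.mem_range.1 hx
  omega

theorem word_add (a b : ℕ) (f : ℕ → ℕ) :
    word (a + b) f = word a f ++ word b fun x => f (a + x) := by
  simp [word, List.range_add, add_assoc, Function.comp_def]

theorem map_word (n : ℕ) (f k : ℕ → ℕ) : (word n f).map k = word n fun x => k (f x) := by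
  simp [word, Function.comp_def]

theorem singleton_eq_word (k : ℕ) : [k] = word 1 fun _ => k := rfl

theorem getElem?_word {n : ℕ} {f : ℕ → ℕ} {x i : ℕ} :
    (word n f)[x]? = some i ↔ x < n ∧ f (x + 1) = i := by
  rw [word, List.getElem?_map, Option.map_eq_some_iff]
  by_cases hx : x < n
  · simp [hx]
  · simp [hx]

theorem append_word (a b : ℕ) (f₁ f₂ : ℕ → ℕ) :
    word a f₁ ++ word b f₂ = word (a + b) fun x => if x ≤ a then f₁ x else f₂ (x - a) := by
  rw [word_add]
  congr 1
  · exact word_congr fun x h1 h2 => by rw [if_pos h2]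
  · exact word_congr fun x h1 h2 => by rw [if_neg (by omega), Nat.add_sub_cancel_left]

theorem compl_word (n : ℕ) (f : ℕ → ℕ) : compl (word n f) = word n fun x => n + 1 - f x := by
  rw [compl, map_word, length_word]

theorem ominus_word (a b : ℕ) (f₁ f₂ : ℕ → ℕ) : ominus (word a f₁) (word b f₂) =
    word (a + b) fun x => if x ≤ a then b + f₁ x else f₂ (x - a) := by
  rw [ominus, map_word, length_word, append_word]

theorem oplus_word (a b : ℕ) (f₁ f₂ : ℕ → ℕ) : oplus (word a f₁) (word b f₂) =
    word (a + b) fun x => if x ≤ a then f₁ x else a + f₂ (x - a) := by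
  rw [oplus, map_word, length_word, append_word]

theorem ominus_nil (w : List ℕ) : ominus w [] = w := by simp [ominus]

/-- `1 ⊕ 1 ⊕ c(w₁) ⊕ 1 ⊕ 1`. -/
def wrapWord (w₁ : Option (List ℕ)) : List ℕ :=
  oplus [1] (oplus (oplus [1] (oplusOne (complAnti w₁))) [1])

theorem wrapWord_none : wrapWord none = word 3 id := rfl

theorem wrapWord_some (n : ℕ) (f : ℕ → ℕ) (hf : ∀ x, 1 ≤ x → x ≤ n → f x ≤ n) :
    wrapWord (some (word n f)) = word (n + 4) (wrapFun n f) := by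
  simp only [wrapWord, complAnti, Option.map_some, compl_word, oplusOne, singleton_eq_word,
    oplus_word]
  rw [show 1 + (1 + (n + 1) + 1) = n + 4 by omega]
  refine word_congr fun x h1 h2 => ?_
  unfold wrapFun
  rcases (by omega : x = 1 ∨ x = 2 ∨ (3 ≤ x ∧ x ≤ n + 2) ∨ x = n + 3 ∨ x = n + 4) with
    rfl | rfl | hx | rfl | rfl
  · simp
  · simp
  · have := hf (x - 2) (by omega) (by omega)
    rw [if_neg (by omega), if_pos (by omega), if_neg (by omega), if_pos (by omega),
      if_neg (by omega), show x - 1 - 1 = x - 2 by omega]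
    omega
  · rw [if_neg (by omega), if_pos (by omega), if_neg (by omega), if_neg (by omega),
      if_pos (by omega)]
    omega
  · rw [if_neg (by omega), if_neg (by omega), if_pos (by omega)]
    omega

theorem ominus_oneOminus_word (a b : ℕ) (f₁ f₂ : ℕ → ℕ) :
    ominus (word a f₁) (oneOminus (some (word b f₂))) = word (a + 1 + b) (stackFun a b f₁ f₂) := by
  simp only [oneOminus, singleton_eq_word, ominus_word]
  rw [← add_assoc]
  refine word_congr fun x h1 h2 => ?_
  unfold stackFun
  rcases (by omega : x ≤ a ∨ x = a + 1 ∨ a + 1 < x) with hx | hx | hx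
  · rw [if_pos hx, if_pos hx]
    omega
  · rw [if_neg (by omega), if_pos (by omega), if_neg (by omega), if_pos hx]
  · rw [if_neg (by omega), if_neg (by omega), if_neg (by omega), if_neg (by omega), Nat.sub_sub]

/-- The words of the complete Baxter permutations which induce snow leopard permutations of odd
length, and the antipermutation. -/
def IsAltBaxterWord : Option (List ℕ) → Prop
  | none => True
  | some w => ∃ n f g, AltBaxter n f g ∧ w = word n f

theorem isAltBaxterWord_wrapWord {w₁ : Option (List ℕ)} (h : IsAltBaxterWord w₁) :
    IsAltBaxterWord (some (wrapWord w₁)) := by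
  rcases w₁ with _ | w
  · exact ⟨3, id, id, AltBaxter.three, wrapWord_none⟩
  · obtain ⟨n, f, g, hf, rfl⟩ := h
    exact ⟨_, _, _, hf.wrap, wrapWord_some n f fun x h1 h2 => (hf.mem x h1 h2).2.1⟩

theorem isAltBaxterWord_ominus {A : List ℕ} {w₂ : Option (List ℕ)}
    (h₁ : IsAltBaxterWord (some A)) (h₂ : IsAltBaxterWord w₂) :
    IsAltBaxterWord (some (ominus A (oneOminus w₂))) := by
  rcases w₂ with _ | w
  · rwa [oneOminus, ominus_nil]
  · obtain ⟨a, f₁, g₁, hf₁, rfl⟩ := h₁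
    obtain ⟨b, f₂, g₂, hf₂, rfl⟩ := h₂
    exact ⟨_, _, _, hf₁.stack hf₂, ominus_oneOminus_word a b f₁ f₂⟩

/-- Complete Baxter permutations with doubly alternating odd part decompose recursively. -/
theorem isAltBaxterWord_some_iff {w : List ℕ} : IsAltBaxterWord (some w) ↔
    ∃ w₁ w₂, IsAltBaxterWord w₁ ∧ IsAltBaxterWord w₂ ∧
      w = ominus (wrapWord w₁) (oneOminus w₂) := by
  constructor
  · rintro ⟨n, f, g, h, rfl⟩
    obtain ⟨q, q4, qn, f1, fq, fq1, hf, hg⟩ := h.exists_first_block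
    have hA := h.block q4 qn hf hg
    obtain ⟨w₁, hw₁, hw₁'⟩ : ∃ w₁, IsAltBaxterWord w₁ ∧
        wrapWord w₁ = word q fun x => f x - (n - q) := by
      have e1 : f 1 - (n - q) = 1 := by omega
      have e2 : f q - (n - q) = q := by omega
      have e3 : f 2 - (n - q) = 2 := hA.apply_two e1
      have e4 : f (q - 1) - (n - q) = q - 1 := hA.apply_sub_one e2
      -- A block of length 3 is `123`, the wrapping of @.
      by_cases hq : q = 3
      · subst hq
        refine ⟨none, trivial, ?_⟩
        rw [wrapWord_none]
        refine word_congr fun x h1 h2 => ?_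
        obtain rfl | rfl | rfl : x = 1 ∨ x = 2 ∨ x = 3 := by omega
        · exact e1.symm
        · exact e3.symm
        · exact e2.symm
      · have hB := hA.unwrap e1 e2 hq
        refine ⟨some _, ⟨_, _, _, hB, rfl⟩, ?_⟩
        rw [wrapWord_some _ _ fun x h1 h2 => (hB.mem x h1 h2).2.1, Nat.sub_add_cancel (by omega)]
        refine word_congr fun x h1 h2 => ?_
        unfold wrapFun
        rcases (by omega : x = 1 ∨ x = 2 ∨ (3 ≤ x ∧ x ≤ q - 2) ∨ x = q - 1 ∨ x = q) with
          rfl | rfl | hx | rfl | rfl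
        · rw [if_pos (by omega), e1]
        · rw [if_pos (by omega), e3]
        · have := hB.mem (x - 2) (by omega) (by omega)
          rw [if_neg (by omega)]
          beta_reduce
          rw [Nat.sub_add_cancel (by omega)] at this ⊢
          omega
        · rw [if_pos (by omega), e4]
        · rw [if_pos (by omega), e2]
    rcases qn.lt_or_eq with hlt | rfl
    · have hC := h.tail q4 hlt (fq1 hlt) hf hg
      refine ⟨w₁, some _, hw₁, ⟨_, _, _, hC, rfl⟩, ?_⟩
      rw [hw₁', ominus_oneOminus_word, show q + 1 + (n - (q + 1)) = n by omega]
      refine word_congr fun x h1 h2 => ?_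
      unfold stackFun
      split_ifs with hx hx
      · have := hf x h1 hx
        beta_reduce
        omega
      · rw [hx, fq1 hlt]
        omega
      · beta_reduce
        rw [Nat.sub_add_cancel (by omega)]
    -- The block is the whole permutation; as 1 ⊖ @ = ∅, the remaining summand is @.
    · refine ⟨w₁, none, hw₁, trivial, ?_⟩
      rw [oneOminus, ominus_nil, hw₁']
      exact word_congr fun x h1 h2 => by omega
  · rintro ⟨w₁, w₂, h₁, h₂, rfl⟩
    exact isAltBaxterWord_ominus (isAltBaxterWord_wrapWord h₁) h₂

end SnowLeopard

-- Translation between lists and functions with inverse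

namespace SnowLeopard

/-- `f` and `g` are mutually inverse permutations of `1, …, n`. -/
structure InverseOn (n : ℕ) (f g : ℕ → ℕ) : Prop where
  mem : ∀ x, 1 ≤ x → x ≤ n → 1 ≤ f x ∧ f x ≤ n ∧ g (f x) = x
  inv_mem : ∀ i, 1 ≤ i → i ≤ n → 1 ≤ g i ∧ g i ≤ n ∧ f (g i) = i

theorem AltBaxter.inverseOn {n : ℕ} {f g : ℕ → ℕ} (h : AltBaxter n f g) : InverseOn n f g :=
  ⟨h.mem, h.inv_mem⟩

theorem range'_eq_word (n : ℕ) : List.range' 1 n = word n id := by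
  rw [word, List.range'_eq_map_range]
  exact List.map_congr_left fun x _ => add_comm 1 x

theorem InverseOn.nodup_word {n : ℕ} {f g : ℕ → ℕ} (h : InverseOn n f g) : (word n f).Nodup := by
  refine List.Nodup.map_on ?_ List.nodup_range
  intro x hx y hy hxy
  rw [List.mem_range] at hx hy
  have h1 := (h.mem (x + 1) (by omega) (by omega)).2.2
  have h2 := (h.mem (y + 1) (by omega) (by omega)).2.2
  rw [hxy, h2] at h1
  omega

theorem InverseOn.isPermWord {n : ℕ} {f g : ℕ → ℕ} (h : InverseOn n f g) :
    IsPermWord (word n f) := by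
  unfold IsPermWord
  rw [List.perm_ext_iff_of_nodup h.nodup_word List.nodup_range', length_word]
  intro i
  simp only [word, List.mem_map, List.mem_range, List.mem_range'_1]
  constructor
  · rintro ⟨x, hx, rfl⟩
    have := h.mem (x + 1) (by omega) (by omega)
    omega
  · intro hi
    have := h.inv_mem i (by omega) (by omega)
    exact ⟨g i - 1, by omega, by rw [Nat.sub_add_cancel this.1, this.2.2]⟩

theorem IsPermWord.exists_inverseOn {w : List ℕ} (h : IsPermWord w) :
    ∃ n f g, InverseOn n f g ∧ w = word n f := by
  have hmem : ∀ i, i ∈ w ↔ 1 ≤ i ∧ i ≤ w.length := by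
    intro i
    rw [h.mem_iff, List.mem_range'_1]
    omega
  have hnd : w.Nodup := h.nodup_iff.2 List.nodup_range'
  have hget : ∀ x (hx : x - 1 < w.length), w.getD (x - 1) 0 = w[x - 1] := fun x hx => by
    simp [hx]
  -- Lists are indexed from 0 and functions from 1, whence the shifts. The default 0 is only taken
  -- outside the range.
  refine ⟨w.length, fun x => w.getD (x - 1) 0, fun i => w.idxOf i + 1, ⟨?_, ?_⟩, ?_⟩
  · intro x h1 h2
    have hx : x - 1 < w.length := by omega
    rw [hget x hx, hnd.idxOf_getElem]
    have := (hmem w[x - 1]).1 (List.getElem_mem hx)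
    omega
  · intro i h1 h2
    have hi := List.idxOf_lt_length_of_mem ((hmem i).2 ⟨h1, h2⟩)
    rw [hget _ (by omega)]
    exact ⟨by omega, by omega, List.getElem_idxOf hi⟩
  · refine List.ext_getElem (by simp) fun x h1 h2 => ?_
    simp [word, h1]

theorem InverseOn.invWord_word {n : ℕ} {f g : ℕ → ℕ} (h : InverseOn n f g) :
    invWord (word n f) = word n g := by
  rw [invWord, length_word, range'_eq_word, map_word]
  refine word_congr fun i h1 h2 => ?_
  have m := h.inv_mem i h1 h2
  have hlt : g i - 1 < (word n f).length := by rw [length_word]; omega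
  have e : (word n f)[g i - 1] = i := by
    have : (word n f)[g i - 1]? = some i := getElem?_word.2 ⟨by omega, by
      rw [Nat.sub_add_cancel m.1, m.2.2]⟩
    rw [List.getElem?_eq_getElem hlt] at this
    exact Option.some.inj this
  have := h.nodup_word.idxOf_getElem (g i - 1) hlt
  rw [e] at this
  rw [id, this]
  omega

theorem isAlternating_word {n : ℕ} {f : ℕ → ℕ} : IsAlternating (word n f) ↔
    ∀ j, 1 ≤ j → j + 1 ≤ n →
      (j % 2 = 1 → f j < f (j + 1)) ∧ (j % 2 = 0 → f (j + 1) < f j) := by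
  simp only [IsAlternating, getElem?_word, Nat.even_iff, Nat.odd_iff]
  constructor
  · intro h j h1 h2
    have := h (j - 1) (f j) (f (j + 1)) ⟨by omega, by rw [Nat.sub_add_cancel h1]⟩
      ⟨by omega, by rw [Nat.sub_add_cancel h1]⟩
    exact ⟨fun _ => this.1 (by omega), fun _ => this.2 (by omega)⟩
  · rintro h j _ _ ⟨h1, rfl⟩ ⟨h2, rfl⟩
    have := h (j + 1) (by omega) (by omega)
    exact ⟨fun _ => this.1 (by omega), fun _ => this.2 (by omega)⟩

theorem InverseOn.isCompleteBaxter_word_iff {n : ℕ} {f g : ℕ → ℕ} (h : InverseOn n f g) :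
    IsCompleteBaxter (word n f) ↔ n % 2 = 1 ∧ (∀ x, 1 ≤ x → x ≤ n → f x % 2 = x % 2) ∧
      ∀ i z, 1 ≤ i → i + 1 ≤ n → (g i < z ∧ z < g (i + 1) ∨ g (i + 1) < z ∧ z < g i) →
        (i % 2 = 1 → f z < i) ∧ (i % 2 = 0 → i + 1 < f z) := by
  constructor
  · intro hw
    refine ⟨by simpa [Nat.odd_iff] using hw.odd_length, ?_, ?_⟩
    · intro x h1 h2
      have := hw.parity (x - 1) (f x)
        (getElem?_word.2 ⟨by omega, by rw [Nat.sub_add_cancel h1]⟩)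
      rw [Nat.sub_add_cancel h1, Nat.even_iff, Nat.even_iff] at this
      omega
    · intro i z h1 h2 hz
      have m := h.inv_mem i h1 (by omega)
      have m' := h.inv_mem (i + 1) (by omega) h2
      have := hw.between (g i - 1) (g (i + 1) - 1) (z - 1) i (f z)
        (getElem?_word.2 ⟨by omega, by rw [Nat.sub_add_cancel m.1, m.2.2]⟩)
        (getElem?_word.2 ⟨by omega, by rw [Nat.sub_add_cancel m'.1, m'.2.2]⟩)
        (getElem?_word.2 ⟨by omega, by rw [Nat.sub_add_cancel (by omega)]⟩) (by omega)
      rwa [Nat.odd_iff, Nat.even_iff] at this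
  · rintro ⟨hn, hp, hb⟩
    refine ⟨h.isPermWord, by simpa [Nat.odd_iff] using hn, ?_, ?_⟩
    · intro x i hx
      obtain ⟨hx, rfl⟩ := getElem?_word.1 hx
      have := hp (x + 1) (by omega) (by omega)
      rw [Nat.even_iff, Nat.even_iff]
      omega
    · intro x y z i m hx hy hz hxyz
      obtain ⟨hx, hx'⟩ := getElem?_word.1 hx
      obtain ⟨hy, hy'⟩ := getElem?_word.1 hy
      obtain ⟨hz, rfl⟩ := getElem?_word.1 hz
      have m1 := h.mem (x + 1) (by omega) (by omega)
      have m2 := h.mem (y + 1) (by omega) (by omega)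
      rw [hx'] at m1
      rw [hy'] at m2
      rw [Nat.odd_iff, Nat.even_iff]
      exact hb i (z + 1) m1.1 m2.2.1 (by omega)

/-- Because parity is preserved, the odd entries are those at odd positions, so filtering takes
every other letter. -/
theorem oddEntries_word (k : ℕ) (f : ℕ → ℕ)
    (hf : ∀ x, 1 ≤ x → x ≤ 2 * k + 1 → f x % 2 = x % 2) :
    oddEntries (word (2 * k + 1) f) = word (k + 1) fun j => (f (2 * j - 1) + 1) / 2 := by
  induction k with
  | zero =>
    have := hf 1 le_rfl le_rfl
    simp [oddEntries, word, this]
  | succ k ih =>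
    have h1 := hf (2 * k + 2) (by omega) (by omega)
    have h2 := hf (2 * k + 3) (by omega) (by omega)
    rw [show 2 * (k + 1) + 1 = 2 * k + 1 + 2 by ring, word_add (2 * k + 1), oddEntries, List.filter_append,
      List.map_append, word_add (k + 1), ← ih fun x hx1 hx2 => hf x hx1 (by omega), oddEntries]
    congr 1
    have e1 : f (2 * k + 1 + 1) % 2 = 0 := by
      rw [show 2 * k + 1 + 1 = 2 * k + 2 by ring]; omega
    have e2 : f (2 * k + 1 + 2) % 2 = 1 := by
      rw [show 2 * k + 1 + 2 = 2 * k + 3 by ring]; omega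
    simp [word, List.range_succ, e1, e2]
    congr 2

theorem evenEntries_word (k : ℕ) (f : ℕ → ℕ)
    (hf : ∀ x, 1 ≤ x → x ≤ 2 * k + 1 → f x % 2 = x % 2) :
    evenEntries (word (2 * k + 1) f) = word k fun j => f (2 * j) / 2 := by
  induction k with
  | zero =>
    have := hf 1 le_rfl le_rfl
    simp [evenEntries, word, this]
  | succ k ih =>
    have h1 := hf (2 * k + 2) (by omega) (by omega)
    have h2 := hf (2 * k + 3) (by omega) (by omega)
    rw [show 2 * (k + 1) + 1 = 2 * k + 1 + 2 by ring, word_add (2 * k + 1), evenEntries, List.filter_append,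
      List.map_append, word_add k, ← ih fun x hx1 hx2 => hf x hx1 (by omega), evenEntries]
    congr 1
    have e1 : f (2 * k + 1 + 1) % 2 = 0 := by
      rw [show 2 * k + 1 + 1 = 2 * k + 2 by ring]; omega
    have e2 : f (2 * k + 1 + 2) % 2 = 1 := by
      rw [show 2 * k + 1 + 2 = 2 * k + 3 by ring]; omega
    simp [word, List.range_succ, e1, e2]
    congr 2

theorem InverseOn.odd {k : ℕ} {f g : ℕ → ℕ} (h : InverseOn (2 * k + 1) f g)
    (hf : ∀ x, 1 ≤ x → x ≤ 2 * k + 1 → f x % 2 = x % 2) :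
    InverseOn (k + 1) (fun j => (f (2 * j - 1) + 1) / 2) fun j => (g (2 * j - 1) + 1) / 2 := by
  constructor
  · intro x h1 h2
    have m := h.mem (2 * x - 1) (by omega) (by omega)
    have p := hf (2 * x - 1) (by omega) (by omega)
    rw [show 2 * ((f (2 * x - 1) + 1) / 2) - 1 = f (2 * x - 1) by omega]
    omega
  · intro i h1 h2
    have m := h.inv_mem (2 * i - 1) (by omega) (by omega)
    have p := hf (g (2 * i - 1)) (by omega) (by omega)
    rw [show 2 * ((g (2 * i - 1) + 1) / 2) - 1 = g (2 * i - 1) by omega]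
    omega

theorem alternating_odd_iff {k : ℕ} {f : ℕ → ℕ}
    (hf : ∀ x, 1 ≤ x → x ≤ 2 * k + 1 → f x % 2 = x % 2) :
    IsAlternating (word (k + 1) fun j => (f (2 * j - 1) + 1) / 2) ↔
      ∀ x, 1 ≤ x → x + 2 ≤ 2 * k + 1 →
        (x % 4 = 1 → f x < f (x + 2)) ∧ (x % 4 = 3 → f (x + 2) < f x) := by
  rw [isAlternating_word]
  constructor
  · intro h x h1 h2
    by_cases hx : x % 2 = 1
    · have := h ((x + 1) / 2) (by omega) (by omega)
      have p := hf x h1 (by omega)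
      have p' := hf (x + 2) (by omega) (by omega)
      rw [show 2 * ((x + 1) / 2) - 1 = x by omega,
        show 2 * ((x + 1) / 2 + 1) - 1 = x + 2 by omega] at this
      omega
    · omega
  · intro h j h1 h2
    have := h (2 * j - 1) (by omega) (by omega)
    have p := hf (2 * j - 1) (by omega) (by omega)
    have p' := hf (2 * j - 1 + 2) (by omega) (by omega)
    rw [show 2 * j - 1 + 2 = 2 * (j + 1) - 1 by omega] at this p'
    omega

/-- For length `2 * k + 1` there are `k` even entries, so their number is odd exactly when the
length is 3 modulo 4. -/
theorem isAltBaxterWord_some_iff_isCompleteBaxter {w : List ℕ} : IsAltBaxterWord (some w) ↔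
    IsCompleteBaxter w ∧ IsDoublyAlternating (oddEntries w) ∧ Odd (evenEntries w).length := by
  constructor
  · rintro ⟨n, f, g, h, rfl⟩
    have hn := h.mod_four
    obtain ⟨k, rfl⟩ : ∃ k, n = 2 * k + 1 := ⟨n / 2, by omega⟩
    refine ⟨h.inverseOn.isCompleteBaxter_word_iff.2 ⟨by omega, h.parity, h.between⟩, ?_, ?_⟩
    · rw [oddEntries_word k f h.parity, IsDoublyAlternating,
        (h.inverseOn.odd h.parity).invWord_word]
      exact ⟨(alternating_odd_iff h.parity).2 h.alt, (alternating_odd_iff h.inv_parity).2 h.inv_alt⟩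
    · rw [evenEntries_word k f h.parity, length_word, Nat.odd_iff]
      omega
  · rintro ⟨hw, ha, hl⟩
    obtain ⟨n, f, g, h, rfl⟩ := hw.isPerm.exists_inverseOn
    obtain ⟨hn, hp, hb⟩ := h.isCompleteBaxter_word_iff.1 hw
    obtain ⟨k, rfl⟩ : ∃ k, n = 2 * k + 1 := ⟨n / 2, by omega⟩
    rw [evenEntries_word k f hp, length_word, Nat.odd_iff] at hl
    rw [oddEntries_word k f hp, IsDoublyAlternating, (h.odd hp).invWord_word,
      alternating_odd_iff hp, alternating_odd_iff] at ha
    · exact ⟨_, f, g, ⟨by omega, h.mem, h.inv_mem, hp, hb, ha.1, ha.2⟩, rfl⟩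
    · intro i h1 h2
      have m := h.inv_mem i h1 h2
      have p := hp (g i) m.1 m.2.1
      rw [m.2.2] at p
      exact p.symm

theorem isOddSnowLeopard_iff {π : Option (List ℕ)} :
    IsOddSnowLeopard π ↔ ∃ w, IsAltBaxterWord w ∧ evenPart w = π := by
  rcases π with _ | a
  · exact ⟨fun _ => ⟨none, trivial, rfl⟩, fun _ => trivial⟩
  · constructor
    · rintro ⟨⟨b, hb, w, hw, rfl, rfl⟩, hl⟩
      exact ⟨some w, isAltBaxterWord_some_iff_isCompleteBaxter.2 ⟨hw, hb, hl⟩, rfl⟩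
    · rintro ⟨_ | w, hw, he⟩
      · cases he
      · obtain rfl := Option.some.inj he
        obtain ⟨h1, h2, h3⟩ := isAltBaxterWord_some_iff_isCompleteBaxter.1 hw
        exact ⟨⟨_, h2, w, h1, rfl, rfl⟩, h3⟩

end SnowLeopard

-- Even and odd entries of sums and complements

namespace SnowLeopard

theorem evenEntries_append (w v : List ℕ) :
    evenEntries (w ++ v) = evenEntries w ++ evenEntries v := by
  simp [evenEntries]

theorem oddEntries_append (w v : List ℕ) :
    oddEntries (w ++ v) = oddEntries w ++ oddEntries v := by
  simp [oddEntries]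

theorem evenEntries_map {f h : ℕ → ℕ} {w : List ℕ} (hf : ∀ v ∈ w, f v % 2 = v % 2)
    (hh : ∀ v ∈ w, v % 2 = 0 → f v / 2 = h (v / 2)) :
    evenEntries (w.map f) = (evenEntries w).map h := by
  induction w with
  | nil => rfl
  | cons v w ih =>
    have h1 := hf v List.mem_cons_self
    have h2 := hh v List.mem_cons_self
    have ih := ih (fun u hu => hf u (List.mem_cons_of_mem _ hu))
      fun u hu => hh u (List.mem_cons_of_mem _ hu)
    unfold evenEntries at ih ⊢
    by_cases hv : v % 2 = 0 <;> simp_all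

theorem oddEntries_map {f h : ℕ → ℕ} {w : List ℕ} (hf : ∀ v ∈ w, f v % 2 = v % 2)
    (hh : ∀ v ∈ w, v % 2 = 1 → (f v + 1) / 2 = h ((v + 1) / 2)) :
    oddEntries (w.map f) = (oddEntries w).map h := by
  induction w with
  | nil => rfl
  | cons v w ih =>
    have h1 := hf v List.mem_cons_self
    have h2 := hh v List.mem_cons_self
    have ih := ih (fun u hu => hf u (List.mem_cons_of_mem _ hu))
      fun u hu => hh u (List.mem_cons_of_mem _ hu)
    unfold oddEntries at ih ⊢
    by_cases hv : v % 2 = 1 <;> simp_all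

/-- Adding one exchanges the parities. This is how odd parts enter the decomposition of even parts.
-/
theorem evenEntries_map_one_add (w : List ℕ) :
    evenEntries (w.map fun i => 1 + i) = oddEntries w := by
  induction w with
  | nil => rfl
  | cons v w ih =>
    unfold evenEntries oddEntries at *
    rcases Nat.mod_two_eq_zero_or_one v with hv | hv
    · have : (1 + v) % 2 = 1 := by omega
      simp_all
    · have : (1 + v) % 2 = 0 := by omega
      simp_all [add_comm]

theorem oddEntries_map_one_add (w : List ℕ) :
    oddEntries (w.map fun i => 1 + i) = (evenEntries w).map fun i => 1 + i := by
  induction w with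
  | nil => rfl
  | cons v w ih =>
    unfold evenEntries oddEntries at *
    rcases Nat.mod_two_eq_zero_or_one v with hv | hv
    · have : (1 + v) % 2 = 1 := by omega
      have : (1 + v + 1) / 2 = 1 + v / 2 := by omega
      simp_all
    · have : (1 + v) % 2 = 0 := by omega
      simp_all

theorem evenEntries_range' (n : ℕ) : evenEntries (List.range' 1 n) = List.range' 1 (n / 2) := by
  induction n with
  | zero => rfl
  | succ n ih =>
    rw [List.range'_1_concat, evenEntries_append, ih, evenEntries]
    rcases Nat.mod_two_eq_zero_or_one n with hn | hn
    · rw [show (n + 1) / 2 = n / 2 by omega]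
      have : ¬ (1 + n) % 2 = 0 := by omega
      simp [this]
    · rw [show (n + 1) / 2 = n / 2 + 1 by omega, List.range'_1_concat]
      have h1 : (1 + n) % 2 = 0 := by omega
      have h2 : (1 + n) / 2 = 1 + n / 2 := by omega
      simp [h1, h2]

theorem oddEntries_range' (n : ℕ) :
    oddEntries (List.range' 1 n) = List.range' 1 ((n + 1) / 2) := by
  induction n with
  | zero => rfl
  | succ n ih =>
    rw [List.range'_1_concat, oddEntries_append, ih, oddEntries]
    rcases Nat.mod_two_eq_zero_or_one n with hn | hn
    · rw [show (n + 1 + 1) / 2 = (n + 1) / 2 + 1 by omega, List.range'_1_concat]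
      have h1 : (1 + n) % 2 = 1 := by omega
      have h2 : (1 + n + 1) / 2 = 1 + (n + 1) / 2 := by omega
      simp [h1, h2]
    · rw [show (n + 1 + 1) / 2 = (n + 1) / 2 by omega]
      have : ¬ (1 + n) % 2 = 1 := by omega
      simp [this]

namespace IsPermWord

variable {w : List ℕ}

theorem mem_iff (h : IsPermWord w) {i : ℕ} : i ∈ w ↔ 1 ≤ i ∧ i ≤ w.length := by
  rw [List.Perm.mem_iff h, List.mem_range'_1]
  omega

theorem nodup (h : IsPermWord w) : w.Nodup := (List.Perm.nodup_iff h).2 List.nodup_range'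

theorem evenEntries_perm (h : IsPermWord w) :
    (evenEntries w).Perm (List.range' 1 (w.length / 2)) := by
  rw [← evenEntries_range']
  exact (List.Perm.filter _ h).map _

theorem oddEntries_perm (h : IsPermWord w) :
    (oddEntries w).Perm (List.range' 1 ((w.length + 1) / 2)) := by
  rw [← oddEntries_range']
  exact (List.Perm.filter _ h).map _

theorem length_evenEntries (h : IsPermWord w) : (evenEntries w).length = w.length / 2 := by
  simpa using h.evenEntries_perm.length_eq

theorem length_oddEntries (h : IsPermWord w) : (oddEntries w).length = (w.length + 1) / 2 := by
  simpa using h.oddEntries_perm.length_eq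

theorem evenEntries (h : IsPermWord w) : IsPermWord (evenEntries w) := by
  unfold IsPermWord
  rw [h.length_evenEntries]
  exact h.evenEntries_perm

theorem oddEntries (h : IsPermWord w) : IsPermWord (oddEntries w) := by
  unfold IsPermWord
  rw [h.length_oddEntries]
  exact h.oddEntries_perm

end IsPermWord

/-- Permutations of odd length, and the antipermutation. -/
def IsOddPermWord (x : Option (List ℕ)) : Prop := ∀ w, x = some w → IsPermWord w ∧ w.length % 2 = 1

/-- `1 ⊕ c(α) ⊕ 1`. -/
def frame (α : Option (List ℕ)) : List ℕ := oplus [1] (oplusOne (complAnti α))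

theorem frame_none : frame none = [1] := rfl

theorem frame_some (w : List ℕ) :
    frame (some w) = [1] ++ (compl w).map (fun i => 1 + i) ++ [w.length + 2] := by
  simp [frame, complAnti, oplusOne, oplus, compl]
  omega

theorem wrapWord_some_eq (w : List ℕ) :
    wrapWord (some w) = [1, 2] ++ (compl w).map (fun i => 2 + i) ++
      [w.length + 3, w.length + 4] := by
  have h : ((fun i => 1 + i) ∘ (fun i => 1 + i) ∘ fun v => w.length + 1 - v) =
      (fun i => 2 + i) ∘ fun v => w.length + 1 - v := by
    funext v
    simp only [Function.comp_apply]
    omega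
  simp [wrapWord, complAnti, oplusOne, oplus, compl, h]
  omega

theorem oddComb_eq (α : Option (List ℕ)) (β : List ℕ) : oddComb α β = ominus (frame α) β := rfl

/-- For `y ≠ @` the first summand is raised by the even number `|y| + 1`, which preserves parity,
and the connector has this even value and survives. -/
theorem evenEntries_ominus_oneOminus (X : List ℕ) {y : Option (List ℕ)} (hy : IsOddPermWord y) :
    evenEntries (ominus X (oneOminus y)) = ominus (evenEntries X) (oneOminus (evenPart y)) := by
  rcases y with _ | v
  · simp [oneOminus, evenPart, ominus_nil]
  · obtain ⟨hp, hl⟩ := hy v rfl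
    have he := hp.length_evenEntries
    have h1 : (v.length + 1) % 2 = 0 := by omega
    simp only [evenPart, oneOminus, Option.map_some, ominus, List.map_cons, List.map_nil,
      List.length_append, List.length_cons, List.length_nil, evenEntries_append]
    congr 1
    · exact evenEntries_map (fun u _ => by omega) fun u _ _ => by omega
    · congr 1
      simp [evenEntries, h1]
      unfold evenEntries at he
      simp at he
      omega

/-- The connector has an even value, so it disappears from the odd part. -/
theorem oddEntries_ominus_oneOminus (X : List ℕ) {y : Option (List ℕ)} (hy : IsOddPermWord y) :
    oddEntries (ominus X (oneOminus y)) = ominus (oddEntries X) (oddPart y) := by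
  rcases y with _ | v
  · simp [oneOminus, oddPart, ominus_nil]
  · obtain ⟨hp, hl⟩ := hy v rfl
    have he := hp.length_oddEntries
    have h1 : (v.length + 1) % 2 = 0 := by omega
    simp only [oddPart, oneOminus, ominus, List.map_cons, List.map_nil,
      List.length_append, List.length_cons, List.length_nil, oddEntries_append]
    rw [← List.nil_append (oddEntries v), ← List.append_assoc]
    congr 1
    rw [List.nil_append]
    have : oddEntries [v.length + 1] = [] := by simp [oddEntries, h1]
    rw [this, List.append_nil]
    exact oddEntries_map (fun u _ => by omega) fun u _ _ => by omega

theorem evenEntries_compl {w : List ℕ} (hp : IsPermWord w) (hl : w.length % 2 = 1) :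
    evenEntries (compl w) = compl (evenEntries w) := by
  have he := hp.length_evenEntries
  refine evenEntries_map (fun v hv => ?_) fun v hv _ => ?_
  · have := hp.mem_iff.1 hv
    omega
  · have := hp.mem_iff.1 hv
    omega

theorem oddEntries_compl {w : List ℕ} (hp : IsPermWord w) (hl : w.length % 2 = 1) :
    oddEntries (compl w) = compl (oddEntries w) := by
  have he := hp.length_oddEntries
  refine oddEntries_map (fun v hv => ?_) fun v hv _ => ?_
  · have := hp.mem_iff.1 hv
    omega
  · have := hp.mem_iff.1 hv
    omega

/-- Of the four added entries only the second and the last but one are even, and `c(x)` is shifted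
by 2, which keeps its parities. -/
theorem evenEntries_wrapWord {x : Option (List ℕ)} (hx : IsOddPermWord x) :
    evenEntries (wrapWord x) = frame (evenPart x) := by
  rcases x with _ | w
  · rfl
  · obtain ⟨hp, hl⟩ := hx w rfl
    have he := hp.length_evenEntries
    have h1 : (w.length + 3) % 2 = 0 := by omega
    have h2 : (w.length + 4) % 2 = 1 := by omega
    have h3 : (w.length + 3) / 2 = (evenEntries w).length + 2 := by omega
    have h4 : evenEntries [w.length + 3, w.length + 4] = [(evenEntries w).length + 2] := by
      rw [← h3]
      simp [evenEntries, h1, h2]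
    rw [wrapWord_some_eq, evenPart, Option.map_some, frame_some, evenEntries_append,
      evenEntries_append, h4, ← evenEntries_compl hp hl,
      evenEntries_map (h := fun i => 1 + i) (fun v _ => by omega) fun v _ _ => by omega]
    rfl

/-- Both added entries are odd, and `c(x)` is shifted by 1, so its odd entries become the even ones.
-/
theorem evenEntries_frame {x : Option (List ℕ)} (hx : IsOddPermWord x) :
    evenEntries (frame x) = compl (oddPart x) := by
  rcases x with _ | w
  · rfl
  · obtain ⟨hp, hl⟩ := hx w rfl
    rw [frame_some, evenEntries_append, evenEntries_append, evenEntries_map_one_add,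
      oddEntries_compl hp hl]
    simp [evenEntries, hl, oddPart]

theorem oddEntries_frame {x : Option (List ℕ)} (hx : IsOddPermWord x) :
    oddEntries (frame x) = frame (evenPart x) := by
  rcases x with _ | w
  · rfl
  · obtain ⟨hp, hl⟩ := hx w rfl
    have he := hp.length_evenEntries
    have h1 : (w.length + 2) % 2 = 1 := by omega
    have h3 : (w.length + 2 + 1) / 2 = (evenEntries w).length + 2 := by omega
    have h4 : oddEntries [w.length + 2] = [(evenEntries w).length + 2] := by
      rw [← h3]
      simp [oddEntries, h1]
    rw [frame_some, oddEntries_append, oddEntries_append, oddEntries_map_one_add,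
      evenEntries_compl hp hl, h4, evenPart, Option.map_some, frame_some]
    rfl

theorem isOddPermWord_of_isAltBaxterWord {x : Option (List ℕ)} (hx : IsAltBaxterWord x) :
    IsOddPermWord x := by
  rintro w rfl
  obtain ⟨n, f, g, h, rfl⟩ := hx
  have := h.mod_four
  exact ⟨h.inverseOn.isPermWord, by rw [length_word]; omega⟩

theorem isOddPermWord_of_isOddSnowLeopard {x : Option (List ℕ)} (hx : IsOddSnowLeopard x) :
    IsOddPermWord x := by
  rintro w rfl
  obtain ⟨⟨b, hb, v, hv, _, rfl⟩, hl⟩ := hx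
  exact ⟨hv.isPerm.evenEntries, Nat.odd_iff.1 hl⟩

/-- Snow leopard permutations of odd length decompose recursively. -/
theorem isOddSnowLeopard_some_iff {w : List ℕ} : IsOddSnowLeopard (some w) ↔
    ∃ x y, IsOddSnowLeopard x ∧ IsOddSnowLeopard y ∧ w = ominus (frame x) (oneOminus y) := by
  have key : ∀ x y, IsAltBaxterWord x → IsAltBaxterWord y →
      evenEntries (ominus (wrapWord x) (oneOminus y)) =
        ominus (frame (evenPart x)) (oneOminus (evenPart y)) := by
    intro x y hx hy
    rw [evenEntries_ominus_oneOminus _ (isOddPermWord_of_isAltBaxterWord hy),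
      evenEntries_wrapWord (isOddPermWord_of_isAltBaxterWord hx)]
  constructor
  · intro h
    obtain ⟨_ | v, hv, he⟩ := isOddSnowLeopard_iff.1 h
    · cases he
    · obtain rfl := Option.some.inj he
      obtain ⟨x, y, hx, hy, rfl⟩ := isAltBaxterWord_some_iff.1 hv
      exact ⟨_, _, isOddSnowLeopard_iff.2 ⟨x, hx, rfl⟩, isOddSnowLeopard_iff.2 ⟨y, hy, rfl⟩,
        key x y hx hy⟩
  · rintro ⟨x, y, hx, hy, rfl⟩
    obtain ⟨u, hu, rfl⟩ := isOddSnowLeopard_iff.1 hx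
    obtain ⟨v, hv, rfl⟩ := isOddSnowLeopard_iff.1 hy
    exact isOddSnowLeopard_iff.2 ⟨_, isAltBaxterWord_some_iff.2 ⟨u, v, hu, hv, rfl⟩,
      congrArg some (key u v hu hv)⟩

theorem evenPart_ominus {x y : Option (List ℕ)} (hx : IsOddSnowLeopard x)
    (hy : IsOddSnowLeopard y) : evenPart (some (ominus (frame x) (oneOminus y))) =
      some (evenComb (oddPart x) (evenPart y)) := by
  rw [evenPart, Option.map_some,
    evenEntries_ominus_oneOminus _ (isOddPermWord_of_isOddSnowLeopard hy),
    evenEntries_frame (isOddPermWord_of_isOddSnowLeopard hx)]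
  rfl

theorem oddPart_ominus {x y : Option (List ℕ)} (hx : IsOddSnowLeopard x)
    (hy : IsOddSnowLeopard y) : oddPart (some (ominus (frame x) (oneOminus y))) =
      oddComb (evenPart x) (oddPart y) := by
  rw [oddPart, oddEntries_ominus_oneOminus _ (isOddPermWord_of_isOddSnowLeopard hy),
    oddEntries_frame (isOddPermWord_of_isOddSnowLeopard hx), oddComb_eq]

end SnowLeopard

-- Encoding of threads by binary trees

namespace SnowLeopard

open BinaryTree

mutual

/-- The even thread encoded by a binary tree. -/
def evenThread : BinaryTree Unit → Option (List ℕ)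
  | .nil => none
  | .node _ l r => some (evenComb (oddThread r) (evenThread l))

/-- The odd thread encoded by a binary tree. -/
def oddThread : BinaryTree Unit → List ℕ
  | .nil => []
  | .node _ l r => oddComb (evenThread l) (oddThread r)

end

mutual

/-- The trees which encode each even thread once, by its leftmost decomposition. -/
def EvenReduced : BinaryTree Unit → Prop
  | .nil => True
  | .node _ l r => EvenReduced l ∧ OddReduced r ∧ ∀ l', r ≠ .node () l' .nil

/-- The trees which encode each odd thread once. -/
def OddReduced : BinaryTree Unit → Prop
  | .nil => True
  | .node _ l r => EvenReduced l ∧ OddReduced r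

end

theorem len_oneOminus (α : Option (List ℕ)) : ((oneOminus α).length : ℤ) = len α + 1 := by
  rcases α with _ | w
  · rfl
  · simp [oneOminus, ominus, len]

theorem length_frame (α : Option (List ℕ)) : ((frame α).length : ℤ) = len α + 2 := by
  rcases α with _ | w
  · rfl
  · simp [frame_some, len, compl]
    omega

theorem length_ominus (w v : List ℕ) : (ominus w v).length = w.length + v.length := by
  simp [ominus]

theorem length_compl (w : List ℕ) : (compl w).length = w.length := by
  simp [compl]

theorem length_evenComb (β : List ℕ) (α : Option (List ℕ)) :
    ((evenComb β α).length : ℤ) = β.length + len α + 1 := by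
  rw [evenComb, length_ominus, length_compl]
  push_cast
  rw [len_oneOminus]
  ring

theorem length_oddComb (α : Option (List ℕ)) (β : List ℕ) :
    ((oddComb α β).length : ℤ) = len α + β.length + 2 := by
  rw [oddComb_eq, length_ominus]
  push_cast
  rw [length_frame]
  ring

theorem len_thread (t : BinaryTree Unit) :
    len (evenThread t) = t.numNodes - 1 ∧ (oddThread t).length = t.numNodes := by
  induction t with
  | nil => exact ⟨rfl, rfl⟩
  | node _ l r hl hr =>
    constructor
    · rw [evenThread, len, length_evenComb, hl.1, hr.2, numNodes]
      push_cast
      ring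
    · zify
      rw [oddThread, length_oddComb, hl.1, hr.2, numNodes]
      push_cast
      ring

/-- The snow leopard permutations `x` and `y` in the recursion are arbitrary, so their even and odd
parts may be prescribed independently by the two subtrees. -/
theorem exists_isOddSnowLeopard (t : BinaryTree Unit) :
    (∃ π, IsOddSnowLeopard π ∧ evenPart π = evenThread t) ∧
      ∃ π, IsOddSnowLeopard π ∧ oddPart π = oddThread t := by
  induction t with
  | nil => exact ⟨⟨none, trivial, rfl⟩, none, trivial, rfl⟩
  | node _ l r hl hr =>
    obtain ⟨⟨x, hx, hx'⟩, ⟨x', hx₁, hx₁'⟩⟩ := hl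
    obtain ⟨⟨y, hy, hy'⟩, ⟨y', hy₁, hy₁'⟩⟩ := hr
    constructor
    · refine ⟨_, isOddSnowLeopard_some_iff.2 ⟨y', x, hy₁, hx, rfl⟩, ?_⟩
      rw [evenPart_ominus hy₁ hx, hy₁', hx', evenThread]
    · refine ⟨_, isOddSnowLeopard_some_iff.2 ⟨x, y', hx, hy₁, rfl⟩, ?_⟩
      rw [oddPart_ominus hx hy₁, hy₁', hx', oddThread]

theorem exists_tree (π : Option (List ℕ)) (hπ : IsOddSnowLeopard π) :
    (∃ t, evenThread t = evenPart π) ∧ ∃ t, oddThread t = oddPart π := by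
  -- Lengths start at -1. The decomposition adds 3 to the two lengths, so both components are
  -- strictly shorter.
  induction hn : (len π + 1).toNat using Nat.strong_induction_on generalizing π with
  | _ n ih =>
    rcases π with _ | w
    · exact ⟨⟨.nil, rfl⟩, .nil, rfl⟩
    · obtain ⟨x, y, hx, hy, rfl⟩ := isOddSnowLeopard_some_iff.1 hπ
      have hlen : len (some (ominus (frame x) (oneOminus y))) = len x + len y + 3 := by
        rw [len, length_ominus]
        push_cast
        rw [length_frame, len_oneOminus]
        ring
      have ge : ∀ z, -1 ≤ len z := by
        intro z
        rcases z with _ | z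
        · exact le_rfl
        · simp only [len]
          omega
      have := ge x
      have := ge y
      rw [hlen] at hn
      obtain ⟨⟨t₁, h₁⟩, ⟨t₂, h₂⟩⟩ := ih _ (by omega) x hx rfl
      obtain ⟨⟨t₃, h₃⟩, ⟨t₄, h₄⟩⟩ := ih _ (by omega) y hy rfl
      rw [evenPart_ominus hx hy, oddPart_ominus hx hy]
      exact ⟨⟨.node () t₃ t₂, by rw [evenThread, h₃, h₂]⟩,
        .node () t₁ t₄, by rw [oddThread, h₁, h₄]⟩

theorem isPermWord_of_evenThread {t : BinaryTree Unit} {w : List ℕ}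
    (h : evenThread t = some w) : IsPermWord w := by
  obtain ⟨⟨_ | π, hπ, he⟩, _⟩ := exists_isOddSnowLeopard t
  · rw [h] at he
    cases he
  · rw [h] at he
    obtain rfl := Option.some.inj he
    exact (isOddPermWord_of_isOddSnowLeopard hπ π rfl).1.evenEntries

theorem isPermWord_oddThread (t : BinaryTree Unit) : IsPermWord (oddThread t) := by
  obtain ⟨_, ⟨_ | π, hπ, he⟩⟩ := exists_isOddSnowLeopard t
  · rw [← he]
    exact List.Perm.refl []
  · rw [← he]
    exact (isOddPermWord_of_isOddSnowLeopard hπ π rfl).1.oddEntries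

/-! ### Every thread is encoded by a reduced tree -/

/-- Replace the leftmost leaf of a tree. -/
def graft : BinaryTree Unit → BinaryTree Unit → BinaryTree Unit
  | .nil, s => s
  | .node _ l r, s => .node () (graft l s) r

theorem evenReduced_graft {t s : BinaryTree Unit} (ht : EvenReduced t) (hs : EvenReduced s) :
    EvenReduced (graft t s) := by
  induction t with
  | nil => exact hs
  | node _ l r hl _ =>
    rw [EvenReduced] at ht
    rw [graft, EvenReduced]
    exact ⟨hl ht.1, ht.2⟩

theorem ominus_assoc (u v w : List ℕ) : ominus (ominus u v) w = ominus u (ominus v w) := by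
  have h : ((fun i => w.length + i) ∘ fun i => v.length + i) =
      fun i => v.length + w.length + i := by
    funext i
    simp only [Function.comp_apply]
    omega
  simp [ominus, h]

/-- `α ⊖ 1 ⊖ γ`. -/
def joinAnti : Option (List ℕ) → List ℕ → List ℕ
  | none, v => v
  | some w, v => ominus w (ominus [1] v)

/-- The leftmost leaf encodes the final @ of the iterated skew sum. Replacing it by `v` brings back
the connector that 1 ⊖ @ = ∅ had absorbed. -/
theorem evenThread_graft (t : BinaryTree Unit) {s : BinaryTree Unit} {v : List ℕ}
    (hs : evenThread s = some v) : evenThread (graft t s) = some (joinAnti (evenThread t) v) := by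
  induction t with
  | nil => exact hs
  | node _ l r hl _ =>
    rw [graft, evenThread, hl, evenThread]
    congr 1
    rcases evenThread l with _ | w
    · simp [joinAnti, evenComb, oneOminus, ominus_nil]
    · simp [joinAnti, evenComb, oneOminus, ominus_assoc]

theorem compl_frame_some {w : List ℕ} (hw : IsPermWord w) :
    compl (frame (some w)) = ominus [1] (ominus w [1]) := by
  simp [frame_some, compl, ominus]
  intro v hv
  have := hw.mem_iff.1 hv
  omega

/-- Both sides are 1 ⊖ α' ⊖ 1 ⊖ 1 ⊖ α when α' ≠ @, and 1 ⊖ 1 ⊖ α when α' = @. This is the redundancy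
that reduced trees exclude; the right-hand tree has an empty right subtree at its root. -/
theorem evenThread_rotate (l l' : BinaryTree Unit) :
    evenThread (.node () l (.node () l' .nil)) =
      evenThread (.node () (graft l' (.node () l .nil)) .nil) := by
  have hs : evenThread (.node () l .nil) = some (oneOminus (evenThread l)) := by
    rw [evenThread, oddThread]
    rfl
  rw [evenThread, oddThread, evenThread, evenThread_graft l' hs, oddThread, oddComb_eq, ominus_nil,
    evenComb, evenComb]
  congr 1
  rcases h : evenThread l' with _ | w
  · rfl
  · rw [compl_frame_some (isPermWord_of_evenThread h)]
    simp only [joinAnti, oneOminus, ominus_assoc]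
    rfl

theorem exists_reduced (t : BinaryTree Unit) :
    (∃ s, EvenReduced s ∧ evenThread s = evenThread t) ∧
      ∃ s, OddReduced s ∧ oddThread s = oddThread t := by
  induction t with
  | nil => exact ⟨⟨.nil, trivial, rfl⟩, .nil, trivial, rfl⟩
  | node _ l r hl hr =>
    obtain ⟨⟨l', hl', el⟩, _⟩ := hl
    obtain ⟨_, ⟨r', hr', er⟩⟩ := hr
    constructor
    -- If the reduced right subtree has the forbidden shape, rotation moves it to the left, where
    -- grafting keeps the tree reduced.
    · by_cases h : ∃ u, r' = .node () u .nil
      · obtain ⟨u, rfl⟩ := h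
        rw [OddReduced] at hr'
        refine ⟨.node () (graft u (.node () l' .nil)) .nil, ?_, ?_⟩
        · rw [EvenReduced]
          refine ⟨evenReduced_graft hr'.1 ?_, trivial, fun _ => nofun⟩
          rw [EvenReduced]
          exact ⟨hl', trivial, fun _ => nofun⟩
        · rw [← evenThread_rotate, evenThread, evenThread, el, er]
      · refine ⟨.node () l' r', ?_, ?_⟩
        · rw [EvenReduced]
          exact ⟨hl', hr', fun u hu => h ⟨u, hu⟩⟩
        · rw [evenThread, evenThread, el, er]
    · refine ⟨.node () l' r', ?_, ?_⟩
      · rw [OddReduced]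
        exact ⟨hl', hr'⟩
      · rw [oddThread, oddThread, el, er]

theorem mem_ET_iff {n : ℤ} {α : Option (List ℕ)} :
    α ∈ ET n ↔ ∃ t, EvenReduced t ∧ (t.numNodes : ℤ) - 1 = n ∧ evenThread t = α := by
  constructor
  · rintro ⟨hn, π, hπ, rfl⟩
    obtain ⟨⟨t, ht⟩, _⟩ := exists_tree π hπ
    obtain ⟨⟨s, hs, hst⟩, _⟩ := exists_reduced t
    refine ⟨s, hs, ?_, hst.trans ht⟩
    rw [← (len_thread s).1, hst, ht, hn]
  · rintro ⟨t, _, hn, rfl⟩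
    exact ⟨(len_thread t).1.trans hn, (exists_isOddSnowLeopard t).1⟩

theorem mem_OT_iff {n : ℕ} {β : List ℕ} :
    β ∈ OT n ↔ ∃ t, OddReduced t ∧ t.numNodes = n ∧ oddThread t = β := by
  constructor
  · rintro ⟨hn, π, hπ, rfl⟩
    obtain ⟨_, ⟨t, ht⟩⟩ := exists_tree π hπ
    obtain ⟨_, ⟨s, hs, hst⟩⟩ := exists_reduced t
    refine ⟨s, hs, ?_, hst.trans ht⟩
    rw [← (len_thread s).2, hst, ht, hn]
  · rintro ⟨t, _, hn, rfl⟩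
    exact ⟨(len_thread t).2.trans hn, (exists_isOddSnowLeopard t).2⟩

/-! ### Leftmost decompositions and injectivity -/

theorem compl_injOn {w v : List ℕ} (hw : IsPermWord w) (hv : IsPermWord v)
    (h : compl w = compl v) : w = v := by
  have hl : w.length = v.length := by rw [← length_compl w, h, length_compl]
  refine List.ext_getElem hl fun i h1 h2 => ?_
  have h3 := hw.mem_iff.1 (List.getElem_mem h1)
  have h4 := hv.mem_iff.1 (List.getElem_mem h2)
  have h5 : (compl w)[i]? = (compl v)[i]? := by rw [h]
  simp [compl, h1, h2] at h5
  omega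

theorem oneOminus_injective {α α' : Option (List ℕ)} (h : oneOminus α = oneOminus α') :
    α = α' := by
  rcases α with _ | w <;> rcases α' with _ | w' <;> simp_all [oneOminus, ominus]

theorem ominus_inj {u u' v v' : List ℕ} (hu : u.length = u'.length)
    (h : ominus u v = ominus u' v') : u = u' ∧ v = v' := by
  obtain ⟨h1, rfl⟩ := List.append_inj h (by simpa using hu)
  exact ⟨List.map_injective_iff.2 (fun a b hab => Nat.add_left_cancel hab) h1, rfl⟩

theorem evenComb_inj {β β' : List ℕ} {α α' : Option (List ℕ)} (hβ : IsPermWord β)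
    (hβ' : IsPermWord β') (hl : β.length = β'.length) (h : evenComb β α = evenComb β' α') :
    β = β' ∧ α = α' := by
  obtain ⟨h1, h2⟩ := ominus_inj (by simpa [length_compl] using hl) h
  exact ⟨compl_injOn hβ hβ' h1, oneOminus_injective h2⟩

theorem frame_inj {α α' : Option (List ℕ)} (hα : ∀ w, α = some w → IsPermWord w)
    (hα' : ∀ w, α' = some w → IsPermWord w) (h : frame α = frame α') : α = α' := by
  rcases α with _ | w <;> rcases α' with _ | w'
  · rfl
  · simp [frame_none, frame_some] at h
  · simp [frame_none, frame_some] at h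
  · rw [frame_some, frame_some, List.append_assoc, List.append_assoc] at h
    have h1 := List.append_cancel_left h
    have h2 := (List.append_inj' h1 rfl).1
    rw [compl_injOn (hα w rfl) (hα' w' rfl)
      (List.map_injective_iff.2 (fun a b hab => Nat.add_left_cancel hab) h2)]

theorem head?_oddComb (α : Option (List ℕ)) (β : List ℕ) :
    (oddComb α β)[0]? = some (β.length + 1) := by
  rcases α with _ | w
  · rfl
  · rfl

/-- The first entry is `|β| + 1`, so the place of the cut can be read off. -/
theorem oddComb_inj {β β' : List ℕ} {α α' : Option (List ℕ)}
    (hα : ∀ w, α = some w → IsPermWord w) (hα' : ∀ w, α' = some w → IsPermWord w)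
    (h : oddComb α β = oddComb α' β') : α = α' ∧ β = β' := by
  have h1 := head?_oddComb α β
  rw [h, head?_oddComb] at h1
  have h2 : β'.length = β.length := by simpa using h1
  have h3 := congrArg List.length h
  rw [oddComb_eq, oddComb_eq] at h h3
  rw [length_ominus, length_ominus] at h3
  obtain ⟨h4, h5⟩ := ominus_inj (by omega) h
  exact ⟨frame_inj hα hα' h4, h5⟩

/-- The conventional index `w.length` exceeds every eligible index, so it cannot compete with a
genuine connector. -/
theorem IsLeftmostConnector.eq {w : List ℕ} {k k' : ℕ} (h : IsLeftmostConnector w k)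
    (h' : IsLeftmostConnector w k') : k = k' := by
  have lt_of : ∀ j, EligibleAt w j → j < w.length := by
    intro j hj
    have := (List.getElem?_eq_some_iff.1 hj.1).1
    rwa [length_compl] at this
  have key : ∀ k k', IsLeftmostConnector w k → IsLeftmostConnector w k' → ¬ k < k' := by
    intro k k' h h' hlt
    rcases h.2 with he | rfl
    · exact h'.1 k hlt he
    · rcases h'.2 with he | rfl
      · have := lt_of _ he
        omega
      · omega
  have := key k k' h h'
  have := key k' k h' h
  omega

/-- The complement of c(β) ⊖ 1 ⊖ α is β ⊕ 1 ⊕ c(α), so connectors before the middle 1 are visible in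
β itself. -/
theorem getElem?_compl_evenComb_left {β : List ℕ} (hβ : IsPermWord β) (α : Option (List ℕ))
    {j : ℕ} (hj : j < β.length) : (compl (evenComb β α))[j]? = β[j]? := by
  have := hβ.mem_iff.1 (List.getElem_mem hj)
  rw [List.getElem?_eq_getElem hj]
  simp only [compl, evenComb, ominus, List.map_append, List.map_map]
  rw [List.getElem?_append_left (by simpa using hj)]
  simp [hj]
  omega

theorem getElem?_compl_evenComb_mid (β : List ℕ) (w : List ℕ) :
    (compl (evenComb β (some w)))[β.length]? = some (β.length + 1) := by
  simp [compl, evenComb, ominus, oneOminus]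
  omega

theorem one_le_of_mem_frame {α : Option (List ℕ)} {v : ℕ} (h : v ∈ frame α) : 1 ≤ v := by
  rcases α with _ | w
  · rw [frame_none, List.mem_singleton] at h
    exact h.ge
  · rw [frame_some] at h
    simp only [List.mem_append, List.mem_singleton, List.mem_map] at h
    omega

/-- The frame contributes no eligible connector if something follows it. -/
theorem not_eligible_oddComb {α : Option (List ℕ)} {β : List ℕ} (h : IsPermWord (oddComb α β))
    (hβ : β ≠ []) {j : ℕ} (h1 : (oddComb α β)[j]? = some (j + 1))
    (h2 : ∀ i u, i < j → (oddComb α β)[i]? = some u → u < j + 1) : False := by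
  have hb : 0 < β.length := List.length_pos_iff.2 hβ
  have hlen : (oddComb α β).length = (frame α).length + β.length := by
    rw [oddComb_eq, length_ominus]
  have hj : j < (oddComb α β).length := (List.getElem?_eq_some_iff.1 h1).1
  have hperm : ∀ i (hi : i < (oddComb α β).length), i ≤ j → (oddComb α β)[i] ≤ j + 1 := by
    intro i hi hij
    rcases hij.lt_or_eq with hlt | rfl
    · exact (h2 i _ hlt (List.getElem?_eq_getElem hi)).le
    · rw [List.getElem?_eq_getElem hi] at h1
      exact (Option.some.inj h1).le
  have hframe : ∀ i (hi : i < (oddComb α β).length), i < (frame α).length →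
      β.length + 1 ≤ (oddComb α β)[i] := by
    intro i hi hif
    have := one_le_of_mem_frame (List.getElem_mem hif)
    simp only [oddComb_eq, ominus]
    rw [List.getElem_append_left (by simpa using hif), List.getElem_map]
    omega
  have hpos : 0 < (frame α).length := by
    have := length_frame α
    rcases α with _ | w
    · exact Nat.one_pos
    · simp only [len] at this
      omega
  have hlast : ∃ hi : (frame α).length - 1 < (oddComb α β).length,
      (oddComb α β)[(frame α).length - 1] = (oddComb α β).length := by
    have hlf : (frame α)[(frame α).length - 1]'(by omega) = (frame α).length := by
      rcases α with _ | w
      · rfl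
      · simp [frame_some, length_compl]
    refine ⟨by omega, ?_⟩
    simp only [oddComb_eq, ominus]
    rw [List.getElem_append_left (by simpa using hpos), List.getElem_map, hlf]
    simp
    omega
  by_cases hjf : j < (frame α).length
  · -- the first `j + 1` entries are different, and lie between `2` and `j + 1`
    have hsub : (oddComb α β).take (j + 1) ⊆ List.range' 2 j := by
      intro v hv
      obtain ⟨i, hi, rfl⟩ := List.mem_take_iff_getElem.1 hv
      have hi' : i < (oddComb α β).length := by omega
      have a := hperm i hi' (by omega)
      have b := hframe i hi' (by omega)
      have := h.mem_iff.1 (List.getElem_mem hi')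
      rw [List.mem_range'_1]
      omega
    have := (h.nodup.sublist (List.take_sublist (j + 1) _)).length_le_of_subset hsub
    rw [List.length_take, List.length_range'] at this
    omega
  -- Behind the frame no left-to-right maximum is possible, since the last entry of the frame is the
  -- greatest of all.
  · obtain ⟨hi, he⟩ := hlast
    have := h2 _ _ (by omega) (List.getElem?_eq_getElem hi)
    omega

/-- An earlier connector would lie in the odd thread of `r`, which reducedness makes empty or a
frame followed by something nonempty; `not_eligible_oddComb` excludes the latter. -/
theorem isLeftmostDecomp_of_evenReduced {l r : BinaryTree Unit}
    (h : EvenReduced (.node () l r)) :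
    IsLeftmostDecomp (evenComb (oddThread r) (evenThread l)) (oddThread r) (evenThread l) := by
  have hβ := isPermWord_oddThread r
  refine ⟨rfl, ?_, ?_⟩
  · rintro j hj ⟨h1, h2⟩
    rw [getElem?_compl_evenComb_left hβ _ hj] at h1
    have h2' : ∀ i u, i < j → (oddThread r)[i]? = some u → u < j + 1 := by
      intro i u hi hu
      refine h2 i u hi ?_
      rwa [getElem?_compl_evenComb_left hβ _ (by omega)]
    rw [EvenReduced] at h
    rcases r with _ | ⟨_, r₁, r₂⟩
    · simp [oddThread] at hj
    · rw [oddThread] at h1 h2' hβ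
      refine not_eligible_oddComb hβ ?_ h1 h2'
      intro hnil
      have hlen := (len_thread r₂).2
      rw [hnil] at hlen
      rcases r₂ with _ | _
      · exact h.2.2 r₁ rfl
      · simp at hlen
  · rcases hα : evenThread l with _ | w
    -- For α = @ the middle 1 is absent, and the conventional index applies.
    · right
      simp [evenComb, oneOminus, ominus_nil, length_compl]
    · left
      refine ⟨getElem?_compl_evenComb_mid _ w, ?_⟩
      intro j u hj hu
      rw [getElem?_compl_evenComb_left hβ _ hj] at hu
      obtain ⟨hj', rfl⟩ := List.getElem?_eq_some_iff.1 hu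
      have := hβ.mem_iff.1 (List.getElem_mem hj')
      omega

theorem IsLeftmostDecomp.unique {w β β' : List ℕ} {α α' : Option (List ℕ)} (hβ : IsPermWord β)
    (hβ' : IsPermWord β') (h : IsLeftmostDecomp w β α) (h' : IsLeftmostDecomp w β' α') :
    β = β' ∧ α = α' :=
  evenComb_inj hβ hβ' (h.2.eq h'.2) (h.1.symm.trans h'.1)

theorem thread_injective (t : BinaryTree Unit) : ∀ s,
    (EvenReduced t → EvenReduced s → evenThread t = evenThread s → t = s) ∧
      (OddReduced t → OddReduced s → oddThread t = oddThread s → t = s) := by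
  induction t with
  | nil =>
    intro s
    rcases s with _ | ⟨_, l, r⟩
    · exact ⟨fun _ _ _ => rfl, fun _ _ _ => rfl⟩
    · constructor
      · intro _ _ h
        rw [evenThread, evenThread] at h
        cases h
      · intro _ _ h
        have := congrArg List.length h
        rw [(len_thread _).2, (len_thread _).2] at this
        simp at this
  | node _ l r hl hr =>
    intro s
    rcases s with _ | ⟨_, l', r'⟩
    · constructor
      · intro _ _ h
        rw [evenThread, evenThread] at h
        cases h
      · intro _ _ h
        have := congrArg List.length h
        rw [(len_thread _).2, (len_thread _).2] at this
        simp at this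
    · constructor
      · intro h1 h2 h
        have d1 := isLeftmostDecomp_of_evenReduced h1
        have d2 := isLeftmostDecomp_of_evenReduced h2
        rw [evenThread, evenThread] at h
        rw [← Option.some.inj h] at d2
        obtain ⟨e1, e2⟩ := d1.unique (isPermWord_oddThread r) (isPermWord_oddThread r') d2
        rw [EvenReduced] at h1 h2
        rw [(hl l').1 h1.1 h2.1 e2, (hr r').2 h1.2.1 h2.2.1 e1]
      · intro h1 h2 h
        rw [oddThread, oddThread] at h
        obtain ⟨e1, e2⟩ := oddComb_inj (fun _ => isPermWord_of_evenThread)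
          (fun _ => isPermWord_of_evenThread) h
        rw [OddReduced] at h1 h2
        rw [(hl l').1 h1.1 h2.1 e1, (hr r').2 h1.2 h2.2 e2]

end SnowLeopard

-- Catalan paths, their reflection and their encoding trees

namespace SnowLeopard

open BinaryTree DyckStep

theorem swapStep_swapStep (s : DyckStep) : swapStep (swapStep s) = s := by cases s <;> rfl

theorem toList_rev (p : DyckWord) : (rev p).toList = p.toList.reverse.map swapStep := rfl

theorem toList_zero : (0 : DyckWord).toList = [] := rfl

theorem toList_add (p q : DyckWord) : (p + q).toList = p.toList ++ q.toList := rfl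

theorem toList_nest (p : DyckWord) : p.nest.toList = [U] ++ p.toList ++ [D] := rfl

@[simp] theorem rev_rev (p : DyckWord) : rev (rev p) = p := by
  apply DyckWord.ext
  have : swapStep ∘ swapStep = id := funext swapStep_swapStep
  simp [toList_rev, ← List.map_reverse, this]

theorem rev_injective : Function.Injective rev := Function.LeftInverse.injective rev_rev

@[simp] theorem rev_zero : rev 0 = 0 := rfl

theorem rev_add (p q : DyckWord) : rev (p + q) = rev q + rev p := by
  apply DyckWord.ext
  simp [toList_rev, toList_add]

theorem rev_nest (p : DyckWord) : rev p.nest = (rev p).nest := by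
  apply DyckWord.ext
  simp [toList_rev, toList_nest, swapStep]

@[simp] theorem semilength_rev (p : DyckWord) : (rev p).semilength = p.semilength := by
  have h1 := (rev p).two_mul_semilength_eq_length
  have h2 := p.two_mul_semilength_eq_length
  have h3 : (rev p).toList.length = p.toList.length := by simp [toList_rev]
  omega

/-- The decomposition of a path at its last return is unique. -/
theorem add_nest_inj {p p' q q' : DyckWord} (h : p + q.nest = p' + q'.nest) :
    p = p' ∧ q = q' := by
  -- Reflection turns the last return into the first one, where `insidePart` and `outsidePart`
  -- recover the pieces.
  have h1 := congrArg rev h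
  rw [rev_add, rev_add, rev_nest, rev_nest] at h1
  have h2 := congrArg DyckWord.insidePart h1
  have h3 := congrArg DyckWord.outsidePart h1
  rw [DyckWord.insidePart_add DyckWord.nest_ne_zero, DyckWord.insidePart_add DyckWord.nest_ne_zero,
    DyckWord.insidePart_nest, DyckWord.insidePart_nest] at h2
  rw [DyckWord.outsidePart_add DyckWord.nest_ne_zero,
    DyckWord.outsidePart_add DyckWord.nest_ne_zero, DyckWord.outsidePart_nest,
    DyckWord.outsidePart_nest, zero_add, zero_add] at h3
  exact ⟨rev_injective h3, rev_injective h2⟩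

theorem exists_add_nest {p : DyckWord} (hp : p ≠ 0) : ∃ a b : DyckWord, p = a + b.nest := by
  have h : rev p ≠ 0 := fun h => hp (by rw [← rev_rev p, h, rev_zero])
  refine ⟨rev (rev p).outsidePart, rev (rev p).insidePart, ?_⟩
  rw [← rev_nest, ← rev_add, DyckWord.nest_insidePart_add_outsidePart h, rev_rev]

theorem add_nest_ne_zero (p q : DyckWord) : p + q.nest ≠ 0 := by
  intro h
  have := congrArg DyckWord.semilength h
  simp at this

mutual

/-- The Catalan path of an even thread, on the encoding trees. -/
def evenPath : BinaryTree Unit → DyckWord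
  | .nil => 0
  | .node _ l r => evenPath l + (rev (oddPath r)).nest

/-- The Catalan path of an odd thread, on the encoding trees. -/
def oddPath : BinaryTree Unit → DyckWord
  | .nil => 0
  | .node _ l r => rev (evenPath l) + (oddPath r).nest

end

theorem semilength_path (t : BinaryTree Unit) :
    (evenPath t).semilength = t.numNodes ∧ (oddPath t).semilength = t.numNodes := by
  induction t with
  | nil => simp [evenPath, oddPath]
  | node _ l r hl hr =>
    simp only [evenPath, oddPath, DyckWord.semilength_add, DyckWord.semilength_nest,
      semilength_rev, hl.1, hr.2, numNodes]
    omega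

theorem path_injective (t : BinaryTree Unit) : ∀ s,
    (evenPath t = evenPath s → t = s) ∧ (oddPath t = oddPath s → t = s) := by
  induction t with
  | nil =>
    intro s
    rcases s with _ | ⟨_, l, r⟩
    · exact ⟨fun _ => rfl, fun _ => rfl⟩
    · rw [evenPath, evenPath, oddPath, oddPath]
      exact ⟨fun h => absurd h.symm (add_nest_ne_zero _ _),
        fun h => absurd h.symm (add_nest_ne_zero _ _)⟩
  | node _ l r hl hr =>
    intro s
    rcases s with _ | ⟨_, l', r'⟩
    · rw [evenPath, evenPath, oddPath, oddPath]
      exact ⟨fun h => absurd h (add_nest_ne_zero _ _), fun h => absurd h (add_nest_ne_zero _ _)⟩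
    · rw [evenPath, evenPath, oddPath, oddPath]
      constructor
      · intro h
        obtain ⟨h1, h2⟩ := add_nest_inj h
        rw [(hl l').1 h1, (hr r').2 (rev_injective h2)]
      · intro h
        obtain ⟨h1, h2⟩ := add_nest_inj h
        rw [(hl l').1 (rev_injective h1), (hr r').2 h2]

theorem path_surjective (p : DyckWord) : (∃ t, evenPath t = p) ∧ ∃ t, oddPath t = p := by
  induction hn : p.semilength using Nat.strong_induction_on generalizing p with
  | _ n ih =>
    by_cases hp : p = 0
    · subst hp
      exact ⟨⟨.nil, by rw [evenPath]⟩, .nil, by rw [oddPath]⟩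
    · obtain ⟨a, b, rfl⟩ := exists_add_nest hp
      rw [DyckWord.semilength_add, DyckWord.semilength_nest] at hn
      obtain ⟨⟨t₁, h₁⟩, _⟩ := ih a.semilength (by omega) a rfl
      obtain ⟨⟨t₂, h₂⟩, _⟩ := ih (rev a).semilength (by rw [semilength_rev]; omega) (rev a) rfl
      obtain ⟨_, t₃, h₃⟩ := ih b.semilength (by omega) b rfl
      obtain ⟨_, t₄, h₄⟩ := ih (rev b).semilength (by rw [semilength_rev]; omega) (rev b) rfl
      exact ⟨⟨.node () t₁ t₄, by rw [evenPath, h₁, h₄, rev_rev]⟩,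
        .node () t₂ t₃, by rw [oddPath, h₂, h₃, rev_rev]⟩

/-! ### Forbidden consecutive steps -/

/-- If `s` occurs in the pattern only as an end letter, an occurrence that covers the displayed `s`
cannot extend beyond it on both sides. -/
theorem infix_append_cons_iff {s : DyckStep} {f l r : List DyckStep}
    (hf : ∀ x y, f = x ++ [s] ++ y → x = [] ∨ y = []) :
    f <:+: l ++ s :: r ↔ f <:+: l ++ [s] ∨ f <:+: s :: r := by
  constructor
  · rintro ⟨u, v, h⟩
    rw [List.append_assoc, List.append_eq_append_iff] at h
    rcases h with ⟨a, rfl, h⟩ | ⟨a, rfl, h⟩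
    · rw [List.append_eq_append_iff] at h
      rcases h with ⟨b, rfl, rfl⟩ | ⟨b, hb, h⟩
      · exact Or.inl ⟨u, b ++ [s], by simp⟩
      · rcases b with _ | ⟨c, b⟩
        · rw [List.append_nil] at hb
          exact Or.inl ⟨u, [s], by simp [hb]⟩
        · rw [List.cons_append, List.cons.injEq] at h
          obtain ⟨rfl, rfl⟩ := h
          rcases hf a b (by simpa using hb) with rfl | rfl
          · right
            exact ⟨[], v, by simp [hb]⟩
          · left
            exact ⟨u, [], by simp [hb]⟩
    · exact Or.inr ⟨a, v, by simpa using h.symm⟩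
  · rintro (h | h)
    · refine h.trans ⟨[], r, by simp⟩
    · exact h.trans ⟨l, [], by simp⟩

theorem infix_concat_iff {s : DyckStep} {f l : List DyckStep} (hf : ¬ f <:+ l ++ [s]) :
    f <:+: l ++ [s] ↔ f <:+: l := by
  rw [List.infix_concat_iff]
  exact ⟨fun h => h.resolve_left hf, Or.inr⟩

theorem NEEN_split {x y : List DyckStep} (h : [U, D, D, U] = x ++ [U] ++ y) :
    x = [] ∨ y = [] := by
  rcases x with _ | ⟨a, _ | ⟨b, _ | ⟨c, _ | ⟨d, x⟩⟩⟩⟩ <;> simp_all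

theorem ENNE_split {x y : List DyckStep} (h : [D, U, U, D] = x ++ [D] ++ y) :
    x = [] ∨ y = [] := by
  rcases x with _ | ⟨a, _ | ⟨b, _ | ⟨c, _ | ⟨d, x⟩⟩⟩⟩ <;> simp_all

/-- A nonempty Catalan path begins with a North step. -/
theorem eq_nil_or_cons (p : DyckWord) : p.toList = [] ∨ ∃ l, p.toList = U :: l := by
  rcases h : p.toList with _ | ⟨s, l⟩
  · exact Or.inl rfl
  · have := p.head_eq_U (by simp [h])
    simp only [h, List.head_cons] at this
    exact Or.inr ⟨l, by rw [this]⟩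

/-- A nonempty Catalan path ends with an East step. -/
theorem eq_nil_or_concat (p : DyckWord) : p.toList = [] ∨ ∃ l, p.toList = l ++ [D] := by
  by_cases h : p.toList = []
  · exact Or.inl h
  · refine Or.inr ⟨p.toList.dropLast, ?_⟩
    rw [← p.getLast_eq_D h, List.dropLast_concat_getLast]

/-- An ascent is always followed by an E because the path ends with E. Putting an E in front treats
an initial ascent like the others. -/
theorem hasAscentTwo_iff (p : DyckWord) : HasAscentTwo p ↔ [D, U, U, D] <:+: D :: p.toList := by
  constructor
  · rintro ⟨x, y, h, hx, hy⟩
    have hy' : ∃ y', y = D :: y' := by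
      rcases y with _ | ⟨s, y'⟩
      · exfalso
        rcases eq_nil_or_concat p with h1 | ⟨l, h1⟩
        · simp [h1] at h
        · rw [h1, List.append_nil, show x ++ [U, U] = (x ++ [U]) ++ [U] by simp] at h
          have := List.append_inj_right' h rfl
          cases this
      · rcases s.dichotomy with rfl | rfl
        · simp at hy
        · exact ⟨y', rfl⟩
    obtain ⟨y', rfl⟩ := hy'
    rcases List.eq_nil_or_concat x with rfl | ⟨x', s, rfl⟩
    · exact ⟨[], y', by simp [h]⟩
    · rcases s.dichotomy with rfl | rfl
      · simp at hx
      · exact ⟨D :: x', y', by simp [h]⟩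
  · rintro ⟨u, v, h⟩
    rcases u with _ | ⟨s, u⟩
    · exact ⟨[], D :: v, by simpa using h.symm, by simp, by simp⟩
    · refine ⟨u ++ [D], D :: v, ?_, by simp, by simp⟩
      simpa using (List.cons.inj h).2.symm

theorem infix_rev_iff (p : DyckWord) :
    [U, D, D, U] <:+: (rev p).toList ↔ [D, U, U, D] <:+: p.toList := by
  have hs : swapStep ∘ swapStep = id := funext swapStep_swapStep
  rw [toList_rev]
  constructor
  · intro h
    have := List.reverse_infix.2 (h.map swapStep)
    simpa [hs, swapStep] using this
  · intro h
    have := (List.reverse_infix.2 h).map swapStep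
    simpa [swapStep] using this

theorem infix_rev_concat_iff (p : DyckWord) :
    [U, D, D, U] <:+: (rev p).toList ++ [U] ↔ HasAscentTwo p := by
  have hs : swapStep ∘ swapStep = id := funext swapStep_swapStep
  rw [hasAscentTwo_iff, toList_rev]
  constructor
  · intro h
    have := List.reverse_infix.2 (h.map swapStep)
    simpa [hs, swapStep] using this
  · intro h
    have := (List.reverse_infix.2 h).map swapStep
    simpa [swapStep] using this

/-- The word is a^r N b E, and N occurs in NEEN only at the ends, so the pattern lies in a^r N or in
N b E. The former reflects to ENNE in E a; the latter reduces to b. -/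
theorem infix_NEEN_odd_iff (a b : DyckWord) : [U, D, D, U] <:+: (rev a + b.nest).toList ↔
    HasAscentTwo a ∨ [U, D, D, U] <:+: b.toList := by
  rw [toList_add, toList_nest, List.append_assoc, List.singleton_append,
    infix_append_cons_iff fun x y => NEEN_split, infix_rev_concat_iff]
  have h1 : ¬ [U, D, D, U] <:+ U :: b.toList ++ [D] := by
    rintro ⟨u, h⟩
    rw [show u ++ [U, D, D, U] = (u ++ [U, D, D]) ++ [U] by simp] at h
    cases List.append_inj_right' h rfl
  rw [← List.cons_append, infix_concat_iff h1, List.infix_cons_iff]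
  -- The pattern continues with E, but `b` is empty or begins with N.
  have h2 : ¬ [U, D, D, U] <+: U :: b.toList := by
    rw [List.cons_prefix_cons]
    rintro ⟨_, h⟩
    rcases eq_nil_or_cons b with hb | ⟨l, hb⟩
    · simp [hb] at h
    · simp [hb, List.cons_prefix_cons] at h
  simp only [h2, false_or]

/-- With an E in front the word is E a N q E, which is cut at the last letter of E a. A new ENNE can
only use this letter and the following N, so `q` must begin with NE. -/
theorem hasAscentTwo_even_iff (a q : DyckWord) : HasAscentTwo (a + q.nest) ↔
    HasAscentTwo a ∨ [D, U, U, D] <:+: q.toList ∨ [U, D] <+: q.toList := by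
  obtain ⟨x, hx⟩ : ∃ x, D :: a.toList = x ++ [D] := by
    rcases eq_nil_or_concat a with h | ⟨l, h⟩
    · exact ⟨[], by simp [h]⟩
    · exact ⟨D :: l, by simp [h]⟩
  rw [hasAscentTwo_iff, hasAscentTwo_iff, toList_add, ← List.cons_append, hx, List.append_assoc,
    List.singleton_append, infix_append_cons_iff fun x y => ENNE_split, toList_nest]
  -- A pattern ending at the final E would need an N before it, but `q` is empty or ends with E.
  have h1 : ¬ [D, U, U, D] <:+ q.toList ++ [D] := by
    rintro ⟨u, h⟩
    rw [show u ++ [D, U, U, D] = (u ++ [D, U, U]) ++ [D] by simp] at h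
    have h := List.append_inj_left' h rfl
    rcases eq_nil_or_concat q with hq | ⟨l, hq⟩
    · simp [hq] at h
    · rw [hq, show u ++ [D, U, U] = (u ++ [D, U]) ++ [U] by simp] at h
      cases List.append_inj_right' h rfl
  have h2 : [U, D] <+: q.toList ++ [D] ↔ [U, D] <+: q.toList := by
    constructor
    · intro h
      rw [List.prefix_concat_iff] at h
      rcases h with h | h
      · have hq : q.toList = [U] := by
          rw [show [U, D] = [U] ++ [D] from rfl] at h
          exact (List.append_inj_left' h rfl).symm
        have := q.count_U_eq_count_D
        simp [hq] at this
      · exact h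
    · intro h
      exact h.trans (List.prefix_append _ _)
  have h3 : [D, U, U, D] <:+: D :: ([U] ++ q.toList ++ [D]) ↔
      [D, U, U, D] <:+: q.toList ∨ [U, D] <+: q.toList := by
    rw [List.infix_cons_iff, List.cons_prefix_cons, List.append_assoc, List.singleton_append,
      List.cons_prefix_cons, h2, List.infix_cons_iff, List.cons_prefix_cons, infix_concat_iff h1]
    simp [or_comm]
  rw [h3]

/-- Reflection moves the last arch of the odd path to the front; this arch is NE exactly when the
right subtree is empty. -/
theorem prefix_rev_oddPath_iff (t : BinaryTree Unit) :
    [U, D] <+: (rev (oddPath t)).toList ↔ ∃ l, t = .node () l .nil := by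
  rcases t with _ | ⟨_, l, r⟩
  · simp [oddPath, toList_zero]
  · rw [oddPath, rev_add, rev_rev, rev_nest, toList_add, toList_nest]
    rcases r with _ | ⟨_, r₁, r₂⟩
    · rw [oddPath, rev_zero, toList_zero]
      simp
    · have hne : rev (oddPath (.node () r₁ r₂)) ≠ 0 := by
        intro h
        have := congrArg DyckWord.semilength h
        rw [semilength_rev, (semilength_path _).2] at this
        simp at this
      rcases eq_nil_or_cons (rev (oddPath (.node () r₁ r₂))) with h | ⟨u, h⟩
      · exact absurd (DyckWord.toList_eq_nil.1 h) hne
      · rw [h]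
        simp [List.cons_prefix_cons]

theorem path_reduced_iff (t : BinaryTree Unit) :
    (¬ HasAscentTwo (evenPath t) ↔ EvenReduced t) ∧
      (¬ [U, D, D, U] <:+: (oddPath t).toList ↔ OddReduced t) := by
  induction t with
  | nil =>
    constructor
    · rw [evenPath, EvenReduced, hasAscentTwo_iff, iff_true]
      intro h
      exact absurd h.length_le (by simp [toList_zero])
    · rw [oddPath, OddReduced, iff_true]
      intro h
      exact absurd h.length_le (by simp [toList_zero])
  | node _ l r hl hr =>
    rw [evenPath, oddPath, infix_NEEN_odd_iff, hasAscentTwo_even_iff, prefix_rev_oddPath_iff,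
      ← infix_rev_iff, rev_rev, EvenReduced, OddReduced, ← hl.1, ← hr.2]
    push Not
    exact ⟨Iff.rfl, Iff.rfl⟩

theorem mem_ENNE_iff {n : ℕ} {p : DyckWord} :
    p ∈ ENNE n ↔ ∃ t, EvenReduced t ∧ t.numNodes = n ∧ evenPath t = p := by
  constructor
  · rintro ⟨hn, hp⟩
    obtain ⟨⟨t, rfl⟩, _⟩ := path_surjective p
    exact ⟨t, (path_reduced_iff t).1.1 hp, (semilength_path t).1.symm.trans hn, rfl⟩
  · rintro ⟨t, ht, rfl, rfl⟩
    exact ⟨(semilength_path t).1, (path_reduced_iff t).1.2 ht⟩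

theorem mem_NEEN_iff {n : ℕ} {p : DyckWord} :
    p ∈ NEEN n ↔ ∃ t, OddReduced t ∧ t.numNodes = n ∧ oddPath t = p := by
  constructor
  · rintro ⟨hn, hp⟩
    obtain ⟨_, ⟨t, rfl⟩⟩ := path_surjective p
    exact ⟨t, (path_reduced_iff t).2.1 hp, (semilength_path t).2.symm.trans hn, rfl⟩
  · rintro ⟨t, ht, rfl, rfl⟩
    exact ⟨(semilength_path t).2, (path_reduced_iff t).2.2 ht⟩

end SnowLeopard

-- The four maps, their recursions and uniqueness

namespace SnowLeopard

open BinaryTree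

/-- The encoding trees of the even threads of length `m - 1`. -/
abbrev EvenTree (m : ℕ) : Type := {t : BinaryTree Unit // EvenReduced t ∧ t.numNodes = m}

/-- The encoding trees of the odd threads of length `m`. -/
abbrev OddTree (m : ℕ) : Type := {t : BinaryTree Unit // OddReduced t ∧ t.numNodes = m}

noncomputable def evenPathEquiv (m : ℕ) : EvenTree m ≃ ENNE m :=
  Equiv.ofBijective (fun t => ⟨evenPath t.1, mem_ENNE_iff.2 ⟨t.1, t.2.1, t.2.2, rfl⟩⟩)
    ⟨fun t s h => Subtype.ext ((path_injective t.1 s.1).1 (congrArg Subtype.val h)), fun p => by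
      obtain ⟨t, h1, h2, h3⟩ := mem_ENNE_iff.1 p.2
      exact ⟨⟨t, h1, h2⟩, Subtype.ext h3⟩⟩

noncomputable def oddPathEquiv (m : ℕ) : OddTree m ≃ NEEN m :=
  Equiv.ofBijective (fun t => ⟨oddPath t.1, mem_NEEN_iff.2 ⟨t.1, t.2.1, t.2.2, rfl⟩⟩)
    ⟨fun t s h => Subtype.ext ((path_injective t.1 s.1).2 (congrArg Subtype.val h)), fun p => by
      obtain ⟨t, h1, h2, h3⟩ := mem_NEEN_iff.1 p.2
      exact ⟨⟨t, h1, h2⟩, Subtype.ext h3⟩⟩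

noncomputable def evenThreadEquiv (m : ℕ) : EvenTree m ≃ ET ((m : ℤ) - 1) :=
  Equiv.ofBijective
    (fun t => ⟨evenThread t.1, mem_ET_iff.2 ⟨t.1, t.2.1, by rw [t.2.2], rfl⟩⟩)
    ⟨fun t s h => Subtype.ext
      ((thread_injective t.1 s.1).1 t.2.1 s.2.1 (congrArg Subtype.val h)), fun α => by
      obtain ⟨t, h1, h2, h3⟩ := mem_ET_iff.1 α.2
      exact ⟨⟨t, h1, by omega⟩, Subtype.ext h3⟩⟩

noncomputable def oddThreadEquiv (m : ℕ) : OddTree m ≃ OT m :=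
  Equiv.ofBijective (fun t => ⟨oddThread t.1, mem_OT_iff.2 ⟨t.1, t.2.1, t.2.2, rfl⟩⟩)
    ⟨fun t s h => Subtype.ext
      ((thread_injective t.1 s.1).2 t.2.1 s.2.1 (congrArg Subtype.val h)), fun β => by
      obtain ⟨t, h1, h2, h3⟩ := mem_OT_iff.1 β.2
      exact ⟨⟨t, h1, h2⟩, Subtype.ext h3⟩⟩

theorem coe_evenPathEquiv {m : ℕ} (t : EvenTree m) : (evenPathEquiv m t).1 = evenPath t.1 := rfl

theorem coe_oddPathEquiv {m : ℕ} (t : OddTree m) : (oddPathEquiv m t).1 = oddPath t.1 := rfl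

theorem coe_evenThreadEquiv {m : ℕ} (t : EvenTree m) :
    (evenThreadEquiv m t).1 = evenThread t.1 := rfl

theorem coe_oddThreadEquiv {m : ℕ} (t : OddTree m) : (oddThreadEquiv m t).1 = oddThread t.1 := rfl

/-- The maps `H` and `J`. -/
noncomputable def pathToThread : PathToThread :=
  (fun m p => evenThreadEquiv m ((evenPathEquiv m).symm p),
    fun m p => oddThreadEquiv m ((oddPathEquiv m).symm p))

/-- The maps `F` and `G`. -/
noncomputable def threadToPath : ThreadToPath :=
  (fun m α => evenPathEquiv m ((evenThreadEquiv m).symm α),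
    fun m β => oddPathEquiv m ((oddThreadEquiv m).symm β))

theorem isHJ_pathToThread : IsHJ pathToThread where
  H_empty p hp := by
    obtain ⟨t, rfl⟩ := (evenPathEquiv 0).surjective p
    have : t.1 = .nil := (path_injective t.1 .nil).1 (hp.trans (by rw [evenPath]))
    simp only [pathToThread, Equiv.symm_apply_apply, coe_evenThreadEquiv, this, evenThread]
  J_empty p hp := by
    obtain ⟨t, rfl⟩ := (oddPathEquiv 0).surjective p
    have : t.1 = .nil := (path_injective t.1 .nil).2 (hp.trans (by rw [oddPath]))
    simp only [pathToThread, Equiv.symm_apply_apply, coe_oddThreadEquiv, this, oddThread]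
  H_rec m k l p a b h := by
    obtain ⟨t, rfl⟩ := (evenPathEquiv m).surjective p
    obtain ⟨s, rfl⟩ := (evenPathEquiv k).surjective a
    obtain ⟨r, rfl⟩ := (oddPathEquiv l).surjective b
    have : t.1 = .node () s.1 r.1 :=
      (path_injective t.1 (.node () s.1 r.1)).1 (h.trans (by rw [evenPath]; rfl))
    simp only [pathToThread, Equiv.symm_apply_apply, coe_evenThreadEquiv, coe_oddThreadEquiv, this,
      evenThread]
  J_rec m k l p a b h := by
    obtain ⟨t, rfl⟩ := (oddPathEquiv m).surjective p
    obtain ⟨s, rfl⟩ := (evenPathEquiv k).surjective a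
    obtain ⟨r, rfl⟩ := (oddPathEquiv l).surjective b
    have : t.1 = .node () s.1 r.1 :=
      (path_injective t.1 (.node () s.1 r.1)).2 (h.trans (by rw [oddPath]; rfl))
    simp only [pathToThread, Equiv.symm_apply_apply, coe_evenThreadEquiv, coe_oddThreadEquiv, this,
      oddThread]

/-- Subtrees of reduced trees are reduced, so the recursion for `T` follows the tree and forces its
values. -/
theorem IsHJ.apply_path {T : PathToThread} (hT : IsHJ T) (t : BinaryTree Unit) :
    (∀ m (ht : EvenReduced t ∧ t.numNodes = m),
      T.1 m (evenPathEquiv m ⟨t, ht⟩) = evenThreadEquiv m ⟨t, ht⟩) ∧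
    (∀ m (ht : OddReduced t ∧ t.numNodes = m),
      T.2 m (oddPathEquiv m ⟨t, ht⟩) = oddThreadEquiv m ⟨t, ht⟩) := by
  induction t with
  | nil =>
    constructor
    · rintro m ⟨h1, rfl⟩
      refine Subtype.ext ((hT.H_empty _ ?_).trans ?_)
      · rw [coe_evenPathEquiv, evenPath]
      · rw [coe_evenThreadEquiv, evenThread]
    · rintro m ⟨h1, rfl⟩
      refine Subtype.ext ((hT.J_empty _ ?_).trans ?_)
      · rw [coe_oddPathEquiv, oddPath]
      · rw [coe_oddThreadEquiv, oddThread]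
  | node _ l r hl hr =>
    constructor
    · rintro m ht
      have h := ht.1
      rw [EvenReduced] at h
      refine Subtype.ext ((hT.H_rec m _ _ _ (evenPathEquiv _ ⟨l, h.1, rfl⟩)
        (oddPathEquiv _ ⟨r, h.2.1, rfl⟩) ?_).trans ?_)
      · rw [coe_evenPathEquiv, coe_evenPathEquiv, coe_oddPathEquiv, evenPath]
      · rw [hl.1, hr.2, coe_evenThreadEquiv, coe_evenThreadEquiv, coe_oddThreadEquiv, evenThread]
    · rintro m ht
      have h := ht.1
      rw [OddReduced] at h
      refine Subtype.ext ((hT.J_rec m _ _ _ (evenPathEquiv _ ⟨l, h.1, rfl⟩)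
        (oddPathEquiv _ ⟨r, h.2, rfl⟩) ?_).trans ?_)
      · rw [coe_evenPathEquiv, coe_oddPathEquiv, coe_oddPathEquiv, oddPath]
      · rw [hl.1, hr.2, coe_evenThreadEquiv, coe_oddThreadEquiv, coe_oddThreadEquiv, oddThread]

theorem IsHJ.eq {T : PathToThread} (hT : IsHJ T) : T = pathToThread := by
  refine Prod.ext (funext fun m => funext fun p => ?_) (funext fun m => funext fun p => ?_)
  · obtain ⟨t, rfl⟩ := (evenPathEquiv m).surjective p
    rw [(hT.apply_path t.1).1 m t.2]
    simp only [pathToThread, Equiv.symm_apply_apply]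
  · obtain ⟨t, rfl⟩ := (oddPathEquiv m).surjective p
    rw [(hT.apply_path t.1).2 m t.2]
    simp only [pathToThread, Equiv.symm_apply_apply]

theorem isFG_threadToPath : IsFG threadToPath where
  F_anti α hα := by
    obtain ⟨t, rfl⟩ := (evenThreadEquiv 0).surjective α
    have : t.1 = .nil :=
      (thread_injective t.1 .nil).1 t.2.1 trivial (hα.trans (by rw [evenThread]))
    simp only [threadToPath, Equiv.symm_apply_apply, coe_evenPathEquiv, this, evenPath]
  G_empty β hβ := by
    obtain ⟨t, rfl⟩ := (oddThreadEquiv 0).surjective β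
    have : t.1 = .nil :=
      (thread_injective t.1 .nil).2 t.2.1 trivial (hβ.trans (by rw [oddThread]))
    simp only [threadToPath, Equiv.symm_apply_apply, coe_oddPathEquiv, this, oddPath]
  F_rec m k l π α β w hw h := by
    obtain ⟨⟨t, ht⟩, rfl⟩ := (evenThreadEquiv m).surjective π
    obtain ⟨s, rfl⟩ := (evenThreadEquiv k).surjective α
    obtain ⟨r, rfl⟩ := (oddThreadEquiv l).surjective β
    rcases t with _ | ⟨_, t₁, t₂⟩
    · rw [coe_evenThreadEquiv, evenThread] at hw
      cases hw
    -- The root of a reduced tree gives a leftmost decomposition. By uniqueness it is the given one,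
    -- so the subtrees encode `α` and `β`.
    · have d := isLeftmostDecomp_of_evenReduced ht.1
      rw [coe_evenThreadEquiv, evenThread] at hw
      rw [Option.some.inj hw] at d
      obtain ⟨e1, e2⟩ :=
        d.unique (isPermWord_oddThread t₂) (isPermWord_oddThread r.1) h
      have h1 := ht.1
      rw [EvenReduced] at h1
      have f1 : t₁ = s.1 := (thread_injective t₁ s.1).1 h1.1 s.2.1 e2
      have f2 : t₂ = r.1 := (thread_injective t₂ r.1).2 h1.2.1 r.2.1 e1
      simp only [threadToPath, Equiv.symm_apply_apply, coe_evenPathEquiv, coe_oddPathEquiv,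
        evenPath, f1, f2]
  G_rec m k l π α β h := by
    obtain ⟨t, rfl⟩ := (oddThreadEquiv m).surjective π
    obtain ⟨s, rfl⟩ := (evenThreadEquiv k).surjective α
    obtain ⟨r, rfl⟩ := (oddThreadEquiv l).surjective β
    have : t.1 = .node () s.1 r.1 := by
      refine (thread_injective t.1 (.node () s.1 r.1)).2 t.2.1 ?_ (h.trans (by rw [oddThread]; rfl))
      rw [OddReduced]
      exact ⟨s.2.1, r.2.1⟩
    simp only [threadToPath, Equiv.symm_apply_apply, coe_evenPathEquiv, coe_oddPathEquiv, this,
      oddPath]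

/-- The recursion for `F` applies only to leftmost decompositions, and every even node of a reduced
tree supplies one. -/
theorem IsFG.apply_thread {T : ThreadToPath} (hT : IsFG T) (t : BinaryTree Unit) :
    (∀ m (ht : EvenReduced t ∧ t.numNodes = m),
      T.1 m (evenThreadEquiv m ⟨t, ht⟩) = evenPathEquiv m ⟨t, ht⟩) ∧
    (∀ m (ht : OddReduced t ∧ t.numNodes = m),
      T.2 m (oddThreadEquiv m ⟨t, ht⟩) = oddPathEquiv m ⟨t, ht⟩) := by
  induction t with
  | nil =>
    constructor
    · rintro m ⟨h1, rfl⟩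
      refine Subtype.ext ((hT.F_anti _ ?_).trans ?_)
      · rw [coe_evenThreadEquiv, evenThread]
      · rw [coe_evenPathEquiv, evenPath]
    · rintro m ⟨h1, rfl⟩
      refine Subtype.ext ((hT.G_empty _ ?_).trans ?_)
      · rw [coe_oddThreadEquiv, oddThread]
      · rw [coe_oddPathEquiv, oddPath]
  | node _ l r hl hr =>
    constructor
    · rintro m ht
      have h := ht.1
      rw [EvenReduced] at h
      refine Subtype.ext ((hT.F_rec m _ _ _ (evenThreadEquiv _ ⟨l, h.1, rfl⟩)
        (oddThreadEquiv _ ⟨r, h.2.1, rfl⟩) _ ?_ (isLeftmostDecomp_of_evenReduced ht.1)).trans ?_)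
      · rw [coe_evenThreadEquiv, evenThread]
      · rw [hl.1, hr.2, coe_evenPathEquiv, coe_evenPathEquiv, coe_oddPathEquiv, evenPath]
    · rintro m ht
      have h := ht.1
      rw [OddReduced] at h
      refine Subtype.ext ((hT.G_rec m _ _ _ (evenThreadEquiv _ ⟨l, h.1, rfl⟩)
        (oddThreadEquiv _ ⟨r, h.2, rfl⟩) ?_).trans ?_)
      · rw [coe_evenThreadEquiv, coe_oddThreadEquiv, coe_oddThreadEquiv, oddThread]
      · rw [hl.1, hr.2, coe_evenPathEquiv, coe_oddPathEquiv, coe_oddPathEquiv, oddPath]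

theorem IsFG.eq {T : ThreadToPath} (hT : IsFG T) : T = threadToPath := by
  refine Prod.ext (funext fun m => funext fun p => ?_) (funext fun m => funext fun p => ?_)
  · obtain ⟨t, rfl⟩ := (evenThreadEquiv m).surjective p
    rw [(hT.apply_thread t.1).1 m t.2]
    simp only [threadToPath, Equiv.symm_apply_apply]
  · obtain ⟨t, rfl⟩ := (oddThreadEquiv m).surjective p
    rw [(hT.apply_thread t.1).2 m t.2]
    simp only [threadToPath, Equiv.symm_apply_apply]

end SnowLeopard

theorem theorem4p5 :
    (∃! T : SnowLeopard.PathToThread, SnowLeopard.IsHJ T) ∧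
    (∃! T : SnowLeopard.ThreadToPath, SnowLeopard.IsFG T) ∧
    (∀ (HJ : SnowLeopard.PathToThread) (FG : SnowLeopard.ThreadToPath),
      SnowLeopard.IsHJ HJ → SnowLeopard.IsFG FG → ∀ m : ℕ,
        Function.LeftInverse (FG.1 m) (HJ.1 m) ∧ Function.RightInverse (FG.1 m) (HJ.1 m) ∧
        Function.LeftInverse (FG.2 m) (HJ.2 m) ∧ Function.RightInverse (FG.2 m) (HJ.2 m)) ∧
    (∀ n : ℕ, Nonempty (SnowLeopard.ET (n : ℤ) ≃ SnowLeopard.ENNE (n + 1)) ∧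
      Nonempty (SnowLeopard.OT n ≃ SnowLeopard.NEEN n)) := by
  refine ⟨⟨_, SnowLeopard.isHJ_pathToThread, fun T hT => hT.eq⟩,
    ⟨_, SnowLeopard.isFG_threadToPath, fun T hT => hT.eq⟩, ?_, ?_⟩
  · intro HJ FG hHJ hFG m
    rw [hHJ.eq, hFG.eq]
    refine ⟨fun p => ?_, fun α => ?_, fun p => ?_, fun β => ?_⟩ <;>
      simp only [SnowLeopard.pathToThread, SnowLeopard.threadToPath, Equiv.symm_apply_apply,
        Equiv.apply_symm_apply]
  · intro n
    constructor
    · have h : (n : ℤ) = ((n + 1 : ℕ) : ℤ) - 1 := by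
        push_cast
        ring
      rw [h]
      exact ⟨(SnowLeopard.evenThreadEquiv _).symm.trans (SnowLeopard.evenPathEquiv _)⟩
    · exact ⟨(SnowLeopard.oddThreadEquiv n).symm.trans (SnowLeopard.oddPathEquiv n)⟩
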